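/- A seller offers two goods to a single additive, risk-neutral bidder whose values $z_1,z_2\ge 0$ are independent with densities $f_1(z_1)=5/(1+z_1)^6$ and $f_2(z_2)=6/(1+z_2)^7$ on $[0,\infty)$; write $f(z)=f_1(z_1)f_2(z_2)$. A mechanism is a pair of functions $\mathcal P:\mathbb R_{\ge 0}^2\to[0,1]^2$ (allocation probabilities) and $\mathcal T:\mathbb R_{\ge 0}^2\to\mathbb R$ (price). It is incentive compatible (IC) if $z\cdot\mathcal P(z)-\mathcal T(z)\ge z\cdot\mathcal P(z')-\mathcal T(z')$ for all $z,z'\in\mathbb R_{\ge0}^2$, and individually rational (IR) if $z\cdot\mathcal P(z)-\mathcal T(z)\ge 0$ for all $z\in\mathbb R_{\ge0}^2$. Its expected revenue is $\int_{\mathbb R_{\ge0}^2}\mathcal T(z)f(z)\,dz$. A mechanism is optimal if it is IC and IR and its expected revenue is at least that of every IC and IR mechanism (all these integrals being well defined and finite). Let $\mathcal X$ and $\mathcal Y$ be the sets of $z\in\mathbb R_{\ge0}^2\setminus\{0\}$ with $-\nabla f(z)\cdot z>3f(z)$ and $-\nabla f(z)\cdot z\le 3f(z)$, respectively, and let $Z_p=\{z\in\mathbb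 R_{\ge0}^2\setminus\{0\}: z_1+z_2\le p\}$. Call $p>0$ a critical bundle price if $Z_p\subseteq\mathcal Y$ and $$\int_{Z_p}\bigl(3f(z)+\nabla f(z)\cdot z\bigr)dz=\int_{\mathcal Y}\bigl(3f(z)+\nabla f(z)\cdot z\bigr)dz-\int_{\mathcal X}\bigl(-\nabla f(z)\cdot z-3f(z)\bigr)dz=1.$$ Then there is exactly one critical bundle price $p^*$; it satisfies $|p^*-0.35725|\le 5\cdot 10^{-6}$ (that is, $p^*\approx 0.35725$); and the mechanism that makes a take-it-or-leave-it offer of the bundle of both goods at price $p^*$ (types with $z_1+z_2>p^*$ receive both goods and pay $p^*$, all other types receive nothing and pay nothing) is an optimal mechanism. -/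

import Mathlib

open MeasureTheory Set

noncomputable section

namespace BundlePricing

/-- The type space `ℝ_{≥0}^n`: nonnegative value vectors (the order on `Fin n → ℝ` is
coordinatewise). -/
def typeSpace (n : ℕ) : Set (Fin n → ℝ) := Ici 0

/-- A direct mechanism: reported values are mapped to allocation probabilities in `[0,1]^n` and a
real price. Only the values on `typeSpace n` matter. -/
structure Mechanism (n : ℕ) where
  alloc : (Fin n → ℝ) → (Fin n → ℝ)
  price : (Fin n → ℝ) → ℝ
  alloc_mem : ∀ z ∈ typeSpace n, ∀ i, alloc z i ∈ Icc (0 : ℝ) 1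

/-- Utility of an additive, risk-neutral bidder with values `z` who gets the items with
probabilities `q` and pays `t`. -/
def utility {n : ℕ} (z q : Fin n → ℝ) (t : ℝ) : ℝ := (∑ i, z i * q i) - t

/-- Incentive compatibility: truthful reporting is optimal for every type. -/
def Mechanism.IsIC {n : ℕ} (M : Mechanism n) : Prop :=
  ∀ z ∈ typeSpace n, ∀ z' ∈ typeSpace n,
    utility z (M.alloc z') (M.price z') ≤ utility z (M.alloc z) (M.price z)

/-- Individual rationality: truthful reporting gives nonnegative utility. -/
def Mechanism.IsIR {n : ℕ} (M : Mechanism n) : Prop :=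
  ∀ z ∈ typeSpace n, 0 ≤ utility z (M.alloc z) (M.price z)

/-- Joint density of independent item values with densities `f i` on `[0,∞)`. -/
def jointDensity {n : ℕ} (f : Fin n → ℝ → ℝ) (z : Fin n → ℝ) : ℝ := ∏ i, f i (z i)

/-- The expected revenue of `M` is a well-defined (finite) integral. -/
def Mechanism.HasRevenue {n : ℕ} (M : Mechanism n) (f : Fin n → ℝ → ℝ) : Prop :=
  IntegrableOn (fun z => M.price z * jointDensity f z) (typeSpace n)

/-- Expected revenue under truthful reporting. -/
def Mechanism.revenue {n : ℕ} (M : Mechanism n) (f : Fin n → ℝ → ℝ) : ℝ :=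
  ∫ z in typeSpace n, M.price z * jointDensity f z

/-- `M` is a revenue-optimal mechanism: it is feasible (IC and IR), and it earns at least as much
expected revenue as every feasible mechanism, all these expected revenues being well-defined. -/
def Mechanism.IsOptimal {n : ℕ} (M : Mechanism n) (f : Fin n → ℝ → ℝ) : Prop :=
  M.IsIC ∧ M.IsIR ∧ M.HasRevenue f ∧
    ∀ M' : Mechanism n, M'.IsIC → M'.IsIR → M'.HasRevenue f ∧ M'.revenue f ≤ M.revenue f

/-- The take-it-or-leave-it offer of the grand bundle at price `p`: types whose total value
exceeds `p` get all items and pay `p`; all others get nothing and pay nothing. -/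
def grandBundle (n : ℕ) (p : ℝ) : Mechanism n where
  alloc z _ := if p < ∑ i, z i then 1 else 0
  price z := if p < ∑ i, z i then p else 0
  alloc_mem := by
    intro z _ i
    split_ifs <;> simp

/-- The function `(n+1) f(z) + ∇f(z) · z`, with `f` the joint density. The gradient is taken within
the type space, so that it is one-sided on the boundary. -/
def nuDensity {n : ℕ} (f : Fin n → ℝ → ℝ) (z : Fin n → ℝ) : ℝ :=
  (n + 1) * jointDensity f z + fderivWithin ℝ (jointDensity f) (typeSpace n) z z

/-- The function `-∇f(z) · z - (n+1) f(z)`. -/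
def muDensity {n : ℕ} (f : Fin n → ℝ → ℝ) (z : Fin n → ℝ) : ℝ :=
  -fderivWithin ℝ (jointDensity f) (typeSpace n) z z - (n + 1) * jointDensity f z

/-- Nonzero types at which `-∇f(z) · z > (n+1) f(z)`. -/
def regionX {n : ℕ} (f : Fin n → ℝ → ℝ) : Set (Fin n → ℝ) :=
  {z | z ∈ typeSpace n ∧ z ≠ 0 ∧
    (n + 1) * jointDensity f z < -fderivWithin ℝ (jointDensity f) (typeSpace n) z z}

/-- Nonzero types at which `-∇f(z) · z ≤ (n+1) f(z)`. -/
def regionY {n : ℕ} (f : Fin n → ℝ → ℝ) : Set (Fin n → ℝ) :=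
  {z | z ∈ typeSpace n ∧ z ≠ 0 ∧
    -fderivWithin ℝ (jointDensity f) (typeSpace n) z z ≤ (n + 1) * jointDensity f z}

/-- Nonzero types whose total value is at most `p`. -/
def zeroRegion (n : ℕ) (p : ℝ) : Set (Fin n → ℝ) :=
  {z | z ∈ typeSpace n ∧ z ≠ 0 ∧ ∑ i, z i ≤ p}

/-- `p` is a critical bundle price for item densities `f` supported on `[0,∞)`. -/
def IsCriticalBundlePrice {n : ℕ} (f : Fin n → ℝ → ℝ) (p : ℝ) : Prop :=
  0 < p ∧ zeroRegion n p ⊆ regionY f ∧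
    (∫ z in zeroRegion n p, nuDensity f z) =
      (∫ z in regionY f, nuDensity f z) - ∫ z in regionX f, muDensity f z ∧
    (∫ z in zeroRegion n p, nuDensity f z) = 1

/-- The two power-law densities `5/(1+t)^6` and `6/(1+t)^7` on `[0,∞)`. -/
def powerLawPair : Fin 2 → ℝ → ℝ :=
  ![fun t => 5 / (1 + t) ^ 6, fun t => 6 / (1 + t) ^ 7]

end BundlePricing

end

noncomputable section

namespace BundlePricing

/-! Revenue is linear in the truthful utility `u`: integrating the price `z · P(z) - u(z)` against
`f` gives the integral of `u` against `-∇f · z - 3f`, which here is `30 * weight 4 5 * slope 6 7 10`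
(`IsIC.revenue_eq`, from `integral_payment`). So two utilities are to be compared against one signed
density.

Below the line `x + y = p` the density is negative (`slope_neg`), and `u ≥ 0`, so utility zero is
best there; the bundle achieves it. Above the line the bundle gives `x + y - p`, and since
allocations are at most 1, `h = x + y - p - u` is nondecreasing in each coordinate. The bundle wins
if the signed density integrates every such `h` to something nonnegative, which is first-order
stochastic dominance (`integral_upperRegion_nonneg`). Testing constants forces the density to have
mass zero above the line, and this is the criticality equation `upperMass p = 0`.

For dominance, subtract from `h` its largest weighted average `k` over quadrants with corner on the
line, and cut the region at a corner that almost attains it. On that quadrant Chebyshev's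
inequality, applied in each variable, bounds the integral below by a bounded nonnegative multiple of
an almost vanishing one. On each half-line of the two leftover strips, `h - k` has nonpositive
weighted integral and the mean of `slope` is also nonpositive, so Chebyshev gives a nonnegative
contribution.

The price is located by a sign change of `upperMass` between rational endpoints. Uniqueness holds
because the mass strictly changes while the density on the added set is nonpositive, and negative on
an open part of it. -/

/-! ### Power weights and Chebyshev's inequality on a half-line -/

lemma hasDerivAt_inv_one_add_pow (n : ℕ) {y : ℝ} (hy : 0 < 1 + y) :
    HasDerivAt (fun y : ℝ => -(1 / ((n + 1) * (1 + y) ^ (n + 1)))) (1 / (1 + y) ^ (n + 2)) y := by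
  have h1 : HasDerivAt (fun y : ℝ => 1 + y) 1 y := (hasDerivAt_id y).const_add 1
  have h2 := (((h1.pow (n + 1)).const_mul ((n : ℝ) + 1)).inv
    (show ((n : ℝ) + 1) * (1 + y) ^ (n + 1) ≠ 0 by positivity)).neg
  have h3 : (n : ℝ) + 1 ≠ 0 := by positivity
  refine (h2.congr_deriv ?_).congr_of_eventuallyEq (Filter.Eventually.of_forall fun z => ?_)
  · simp only [Pi.pow_apply, Nat.add_sub_cancel]
    push_cast
    field_simp
    ring
  · simp

lemma tendsto_inv_one_add_pow (n : ℕ) :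
    Filter.Tendsto (fun y : ℝ => -(1 / ((n + 1) * (1 + y) ^ (n + 1)))) Filter.atTop
      (nhds 0) := by
  have h1 : Filter.Tendsto (fun y : ℝ => (1 + y) ^ (n + 1)) Filter.atTop Filter.atTop :=
    (Filter.tendsto_pow_atTop (by omega)).comp (Filter.tendsto_atTop_add_const_left _ _ Filter.tendsto_id)
  have h2 := (h1.const_mul_atTop (show (0 : ℝ) < n + 1 by positivity)).inv_tendsto_atTop.neg
  simpa [Function.comp_def] using h2

lemma integrableOn_inv_one_add_pow (n : ℕ) {b : ℝ} (hb : 0 ≤ b) :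
    IntegrableOn (fun y : ℝ => 1 / (1 + y) ^ (n + 2)) (Ioi b) :=
  integrableOn_Ioi_deriv_of_nonneg'
    (fun y hy => hasDerivAt_inv_one_add_pow n (by linarith [mem_Ici.1 hy]))
    (fun y hy => by have : 0 < 1 + y := by linarith [mem_Ioi.1 hy]
                    positivity) (tendsto_inv_one_add_pow n)

lemma integral_inv_one_add_pow (n : ℕ) {b : ℝ} (hb : 0 ≤ b) :
    ∫ y in Ioi b, 1 / (1 + y) ^ (n + 2) = 1 / ((n + 1) * (1 + b) ^ (n + 1)) := by
  rw [integral_Ioi_of_hasDerivAt_of_nonneg'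
    (fun y hy => hasDerivAt_inv_one_add_pow n (by linarith [mem_Ici.1 hy]))
    (fun y hy => by have : 0 < 1 + y := by linarith [mem_Ioi.1 hy]
                    positivity) (tendsto_inv_one_add_pow n)]
  ring

/-- Under the weight on `(b, ∞)` the mean of `(n + 2) / (1 + y)` is `(n + 1) / (1 + b)`. This is the
centring used in every Chebyshev estimate below. -/
lemma integral_inv_one_add_pow_centered (n : ℕ) {b : ℝ} (hb : 0 ≤ b) :
    ∫ y in Ioi b, 1 / (1 + y) ^ (n + 2) * ((n + 1) / (1 + b) - (n + 2) / (1 + y)) = 0 := by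
  have hb' : 0 < 1 + b := by linarith
  have h : ∀ y ∈ Ioi b, 1 / (1 + y) ^ (n + 2) * ((n + 1) / (1 + b) - (n + 2) / (1 + y)) =
      (n + 1) / (1 + b) * (1 / (1 + y) ^ (n + 2)) - (n + 2) * (1 / (1 + y) ^ (n + 1 + 2)) := by
    intro y hy
    have : 0 < 1 + y := by linarith [mem_Ioi.1 hy]
    field_simp
    ring
  rw [setIntegral_congr_fun measurableSet_Ioi h, integral_sub
    ((integrableOn_inv_one_add_pow n hb).const_mul _)
    ((integrableOn_inv_one_add_pow (n + 1) hb).const_mul _), integral_const_mul,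
    integral_const_mul, integral_inv_one_add_pow n hb, integral_inv_one_add_pow (n + 1) hb]
  push_cast
  have h3 : (n : ℝ) + 1 ≠ 0 := by positivity
  have h4 : (n : ℝ) + 1 + 1 ≠ 0 := by positivity
  field_simp
  ring

lemma integrableOn_mul_affine_inv {b c k : ℝ} (hb : 0 ≤ b) {g : ℝ → ℝ}
    (hg : IntegrableOn g (Ioi b)) : IntegrableOn (fun y => g y * (c - k / (1 + y))) (Ioi b) := by
  refine Integrable.mul_bdd (c := |c| + |k|) hg
    (Measurable.aestronglyMeasurable (by fun_prop)) ?_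
  refine (ae_restrict_iff' measurableSet_Ioi).2 (Filter.Eventually.of_forall fun y hy => ?_)
  have h1 : 1 ≤ 1 + y := by linarith [mem_Ioi.1 hy]
  refine (norm_sub_le _ _).trans ?_
  rw [Real.norm_eq_abs, Real.norm_eq_abs, abs_div, abs_of_pos (zero_lt_one.trans_le h1)]
  gcongr
  exact div_le_self (abs_nonneg _) h1

/-- The Chebyshev inequality against the increasing function `c - (n + 2) / (1 + y)`, for the weight
`(1 + y) ^ (-(n + 2))` on a half-line. -/
lemma chebyshev_Ioi (n : ℕ) {b c : ℝ} (hb : 0 ≤ b) {g : ℝ → ℝ} (hg : Monotone g)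
    (hi : IntegrableOn (fun y => g y * (1 / (1 + y) ^ (n + 2))) (Ioi b)) :
    (c - (n + 1) / (1 + b)) * ∫ y in Ioi b, g y * (1 / (1 + y) ^ (n + 2)) ≤
      ∫ y in Ioi b, g y * (1 / (1 + y) ^ (n + 2)) * (c - (n + 2) / (1 + y)) := by
  have hb' : 0 < 1 + b := by linarith
  have hn : (0 : ℝ) < n + 1 := by positivity
  -- `t` is the sign change of the centred increasing factor. Subtracting `g t` makes its product
  -- with `g - g t` pointwise nonnegative and costs nothing, the factor having weighted integral
  -- zero.
  obtain ⟨t, ht⟩ : ∃ t : ℝ, 1 + t = (n + 2) * (1 + b) / (n + 1) :=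
    ⟨(n + 2) * (1 + b) / (n + 1) - 1, by ring⟩
  have ht' : 0 < 1 + t := by rw [ht]; positivity
  have hw := integrableOn_mul_affine_inv (c := (n + 1) / (1 + b)) (k := n + 2) hb
    (integrableOn_inv_one_add_pow n hb)
  have key : ∫ y in Ioi b, ((c - (n + 1) / (1 + b)) * (g y * (1 / (1 + y) ^ (n + 2))) +
      g t * (1 / (1 + y) ^ (n + 2) * ((n + 1) / (1 + b) - (n + 2) / (1 + y)))) ≤
      ∫ y in Ioi b, g y * (1 / (1 + y) ^ (n + 2)) * (c - (n + 2) / (1 + y)) := by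
    refine setIntegral_mono_on ((hi.const_mul _).add (hw.const_mul _)) (integrableOn_mul_affine_inv hb hi)
      measurableSet_Ioi fun y hy => ?_
    have hy' : 0 < 1 + y := by linarith [mem_Ioi.1 hy]
    have hprod : 0 ≤ (g y - g t) * ((n + 1) / (1 + b) - (n + 2) / (1 + y)) := by
      rcases le_total t y with h | h
      · refine mul_nonneg (sub_nonneg.2 (hg h)) (sub_nonneg.2 ?_)
        rw [div_le_div_iff₀ hy' hb', mul_comm (n + 1 : ℝ), ← div_le_iff₀ hn, ← ht]
        linarith
      · refine mul_nonneg_of_nonpos_of_nonpos (sub_nonpos.2 (hg h)) (sub_nonpos.2 ?_)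
        rw [div_le_div_iff₀ hb' hy', mul_comm (n + 1 : ℝ), ← le_div_iff₀ hn, ← ht]
        linarith
    have hpos : 0 ≤ 1 / (1 + y) ^ (n + 2) := by positivity
    nlinarith [mul_nonneg hpos hprod]
  rwa [integral_add (hi.const_mul _) (hw.const_mul _), integral_const_mul, integral_const_mul,
    integral_inv_one_add_pow_centered n hb, mul_zero, add_zero] at key

/-! ### Weights on quadrants -/

/-- The open quadrant above and to the right of `(a, b)`. -/
def quadrant (a b : ℝ) : Set (ℝ × ℝ) := Ioi a ×ˢ Ioi b

/-- The product power weight `(1 + x) ^ (-(m + 2)) * (1 + y) ^ (-(n + 2))`. -/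
def weight (m n : ℕ) (z : ℝ × ℝ) : ℝ := 1 / (1 + z.1) ^ (m + 2) * (1 / (1 + z.2) ^ (n + 2))

/-- The function `c - a / (1 + x) - b / (1 + y)`. -/
def slope (a b c : ℝ) (z : ℝ × ℝ) : ℝ := c - a / (1 + z.1) - b / (1 + z.2)

lemma measurableSet_quadrant (a b : ℝ) : MeasurableSet (quadrant a b) :=
  measurableSet_Ioi.prod measurableSet_Ioi

lemma measurable_weight (m n : ℕ) : Measurable (weight m n) := by unfold weight; fun_prop

lemma measurable_slope (a b c : ℝ) : Measurable (slope a b c) := by unfold slope; fun_prop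

lemma quadrant_subset {a b : ℝ} (ha : 0 ≤ a) (hb : 0 ≤ b) : quadrant a b ⊆ quadrant 0 0 :=
  prod_mono (Ioi_subset_Ioi ha) (Ioi_subset_Ioi hb)

lemma weight_pos {m n : ℕ} {z : ℝ × ℝ} (hz : z ∈ quadrant 0 0) : 0 < weight m n z := by
  have h1 : 0 < z.1 := hz.1
  have h2 : 0 < z.2 := hz.2
  unfold weight
  positivity

lemma integrableOn_weight (m n : ℕ) {a b : ℝ} (ha : 0 ≤ a) (hb : 0 ≤ b) :
    IntegrableOn (weight m n) (quadrant a b) := by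
  have := (integrableOn_inv_one_add_pow m ha).mul_prod (integrableOn_inv_one_add_pow n hb)
  rwa [Measure.prod_restrict] at this

lemma integral_weight (m n : ℕ) {a b : ℝ} (ha : 0 ≤ a) (hb : 0 ≤ b) :
    ∫ z in quadrant a b, weight m n z =
      1 / ((m + 1) * (1 + a) ^ (m + 1)) * (1 / ((n + 1) * (1 + b) ^ (n + 1))) := by
  rw [← integral_inv_one_add_pow m ha, ← integral_inv_one_add_pow n hb]
  exact setIntegral_prod_mul (fun x : ℝ => 1 / (1 + x) ^ (m + 2)) (fun y => 1 / (1 + y) ^ (n + 2))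
    (Ioi a) (Ioi b)

lemma abs_slope_le (a b c : ℝ) {z : ℝ × ℝ} (hz : z ∈ quadrant 0 0) :
    |slope a b c z| ≤ |c| + |a| + |b| := by
  have h1 : 1 ≤ 1 + z.1 := by have : 0 < z.1 := hz.1
                              linarith
  have h2 : 1 ≤ 1 + z.2 := by have : 0 < z.2 := hz.2
                              linarith
  have h3 : |a / (1 + z.1)| ≤ |a| := by
    rw [abs_div, abs_of_pos (zero_lt_one.trans_le h1)]
    exact div_le_self (abs_nonneg a) h1
  have h4 : |b / (1 + z.2)| ≤ |b| := by
    rw [abs_div, abs_of_pos (zero_lt_one.trans_le h2)]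
    exact div_le_self (abs_nonneg b) h2
  have h5 := abs_sub c (a / (1 + z.1))
  have h6 := abs_sub (c - a / (1 + z.1)) (b / (1 + z.2))
  rw [slope]
  linarith

lemma integrableOn_mul_slope (a b c : ℝ) {F : ℝ × ℝ → ℝ} {S : Set (ℝ × ℝ)}
    (hS : MeasurableSet S) (hS0 : S ⊆ quadrant 0 0) (hF : IntegrableOn F S) :
    IntegrableOn (fun z => F z * slope a b c z) S :=
  Integrable.mul_bdd (c := |c| + |a| + |b|) hF (measurable_slope a b c).aestronglyMeasurable
    ((ae_restrict_iff' hS).2 (Filter.Eventually.of_forall fun _ hz => abs_slope_le a b c (hS0 hz)))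

/-- Linear growth in each variable costs one power of each factor; with `m, n ≥ 1` the remaining
exponents are still at least 2. -/
lemma integrableOn_mul_weight_of_bound {m n : ℕ} (hm : 1 ≤ m) (hn : 1 ≤ n) {v : ℝ × ℝ → ℝ} {C : ℝ}
    (hv : AEStronglyMeasurable v (volume.restrict (quadrant 0 0)))
    (hb : ∀ z ∈ quadrant 0 0, |v z| ≤ C * ((1 + z.1) * (1 + z.2))) :
    IntegrableOn (fun z => v z * weight m n z) (quadrant 0 0) := by
  obtain ⟨m, rfl⟩ := Nat.exists_eq_add_of_le' hm
  obtain ⟨n, rfl⟩ := Nat.exists_eq_add_of_le' hn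
  refine Integrable.mono' ((integrableOn_weight m n le_rfl le_rfl).const_mul C)
    (hv.mul (measurable_weight _ _).aestronglyMeasurable)
    ((ae_restrict_iff' (measurableSet_quadrant _ _)).2 (Filter.Eventually.of_forall fun z hz => ?_))
  have h1 : 0 < z.1 := hz.1
  have h2 : 0 < z.2 := hz.2
  rw [norm_mul, Real.norm_eq_abs, Real.norm_eq_abs, abs_of_pos (weight_pos hz)]
  refine (mul_le_mul_of_nonneg_right (hb z hz) (weight_pos hz).le).trans (le_of_eq ?_)
  simp only [weight]
  field_simp
  ring

/-! ### Chebyshev inequalities for monotone functions of two variables -/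

/-- Coordinatewise nondecreasing functions of at most linear growth in each variable. -/
structure TameMonotone (h : ℝ × ℝ → ℝ) : Prop where
  mono : Monotone h
  meas : Measurable h
  bound : ∃ C, 0 ≤ C ∧ ∀ z ∈ quadrant 0 0, |h z| ≤ C * ((1 + z.1) * (1 + z.2))

namespace TameMonotone

variable {h : ℝ × ℝ → ℝ}

lemma comp_swap (hh : TameMonotone h) : TameMonotone (h ∘ Prod.swap) where
  mono := fun _ _ hzz => hh.mono ⟨hzz.2, hzz.1⟩
  meas := hh.meas.comp measurable_swap
  bound := by
    obtain ⟨C, hC, hb⟩ := hh.bound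
    refine ⟨C, hC, fun z hz => ?_⟩
    rw [mul_comm (1 + z.1)]
    exact hb z.swap ⟨hz.2, hz.1⟩

lemma sub_const (hh : TameMonotone h) (k : ℝ) : TameMonotone (fun z => h z - k) where
  mono := fun _ _ hzz => sub_le_sub_right (hh.mono hzz) k
  meas := hh.meas.sub_const k
  bound := by
    obtain ⟨C, hC, hb⟩ := hh.bound
    refine ⟨C + |k|, by positivity, fun z hz => (abs_sub _ _).trans ?_⟩
    have h1 : 0 < z.1 := hz.1
    have h2 : 0 < z.2 := hz.2
    have : 1 ≤ (1 + z.1) * (1 + z.2) := by nlinarith [mul_pos h1 h2]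
    nlinarith [hb z hz, abs_nonneg k]

lemma integrableOn_mul_weight (hh : TameMonotone h) {m n : ℕ} (hm : 1 ≤ m) (hn : 1 ≤ n) :
    IntegrableOn (fun z => h z * weight m n z) (quadrant 0 0) := by
  obtain ⟨C, -, hb⟩ := hh.bound
  exact integrableOn_mul_weight_of_bound hm hn hh.meas.aestronglyMeasurable hb

lemma integrableOn_line (hh : TameMonotone h) {n : ℕ} (hn : 1 ≤ n) {x : ℝ} (hx : 0 < x) {b : ℝ}
    (hb0 : 0 ≤ b) : IntegrableOn (fun y => h (x, y) * (1 / (1 + y) ^ (n + 2))) (Ioi b) := by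
  obtain ⟨n, rfl⟩ := Nat.exists_eq_add_of_le' hn
  obtain ⟨C, hC, hb⟩ := hh.bound
  have hm : Measurable h := hh.meas
  refine Integrable.mono' ((integrableOn_inv_one_add_pow n hb0).const_mul (C * (1 + x)))
    (Measurable.aestronglyMeasurable (by fun_prop))
    ((ae_restrict_iff' measurableSet_Ioi).2 (Filter.Eventually.of_forall fun y hy => ?_))
  have hy : 0 < y := hb0.trans_lt hy
  have h3 : (0 : ℝ) < 1 / (1 + y) ^ (n + 1 + 2) := by positivity
  rw [norm_mul, Real.norm_eq_abs, Real.norm_eq_abs, abs_of_pos h3]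
  refine (mul_le_mul_of_nonneg_right (hb (x, y) ⟨hx, hy⟩) h3.le).trans (le_of_eq ?_)
  field_simp
  ring

lemma mono_line (hh : TameMonotone h) (x : ℝ) : Monotone fun y => h (x, y) :=
  fun _ _ hy => hh.mono ⟨le_rfl, hy⟩

lemma integral_quadrant_centered_nonneg (hh : TameMonotone h) {m n : ℕ} (hm : 1 ≤ m) (hn : 1 ≤ n)
    {a b : ℝ} (ha : 0 ≤ a) (hb : 0 ≤ b) :
    0 ≤ ∫ z in quadrant a b, h z * weight m n z * slope 0 (n + 2) ((n + 1) / (1 + b)) z := by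
  have hi := integrableOn_mul_slope 0 (n + 2) ((n + 1) / (1 + b)) (measurableSet_quadrant a b)
    (quadrant_subset ha hb) ((hh.integrableOn_mul_weight hm hn).mono_set (quadrant_subset ha hb))
  unfold quadrant at hi ⊢
  rw [Measure.volume_eq_prod, setIntegral_prod _ hi]
  refine setIntegral_nonneg measurableSet_Ioi fun x hx => ?_
  have hx0 : 0 < x := ha.trans_lt hx
  have h1 := chebyshev_Ioi n (c := (n + 1) / (1 + b)) hb (hh.mono_line x)
    (hh.integrableOn_line hn hx0 hb)
  rw [sub_self, zero_mul] at h1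
  have h2 := mul_nonneg (show (0 : ℝ) ≤ 1 / (1 + x) ^ (m + 2) by positivity) h1
  rw [← integral_const_mul] at h2
  refine h2.trans_eq (setIntegral_congr_fun measurableSet_Ioi fun y _ => ?_)
  simp only [weight, slope]
  ring

end TameMonotone

lemma setIntegral_swap (F : ℝ × ℝ → ℝ) (S : Set (ℝ × ℝ)) :
    ∫ z in Prod.swap ⁻¹' S, F z.swap = ∫ z in S, F z :=
  Measure.measurePreserving_swap.setIntegral_preimage_emb
    MeasurableEquiv.prodComm.measurableEmbedding F S

lemma weight_swap (m n : ℕ) (z : ℝ × ℝ) : weight m n z.swap = weight n m z := mul_comm _ _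

lemma slope_swap (a b c : ℝ) (z : ℝ × ℝ) : slope a b c z.swap = slope b a c z := by
  simp only [slope, Prod.fst_swap, Prod.snd_swap]
  ring

lemma preimage_swap_quadrant (a b : ℝ) : Prod.swap ⁻¹' quadrant a b = quadrant b a :=
  preimage_swap_prod _ _

/-- The part `x ≤ s` of the half-quadrant `x + y > p`. -/
def strip (p s : ℝ) : Set (ℝ × ℝ) := {z | 0 < z.1 ∧ z.1 ≤ s ∧ p < z.1 + z.2}

lemma measurableSet_strip (p s : ℝ) : MeasurableSet (strip p s) :=
  (measurableSet_lt measurable_const measurable_fst).inter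
    ((measurableSet_le measurable_fst measurable_const).inter
      (measurableSet_lt measurable_const (measurable_fst.add measurable_snd)))

lemma strip_subset {p s : ℝ} (hs : s ≤ p) : strip p s ⊆ quadrant 0 0 :=
  fun z hz => ⟨hz.1, by have := hz.2.1; have := hz.2.2; simp only [mem_Ioi]; linarith⟩

namespace TameMonotone

variable {h : ℝ × ℝ → ℝ}

/-- Minus its weighted mean over the quadrant, `slope` is a sum of two centred functions, one of
each variable. The second variable is handled by Fubini and the half-line inequality, the first by
reflection. -/
lemma chebyshev_quadrant (hh : TameMonotone h) {m n : ℕ} (hm : 1 ≤ m) (hn : 1 ≤ n) {a b c : ℝ}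
    (ha : 0 ≤ a) (hb : 0 ≤ b) :
    (c - (m + 1) / (1 + a) - (n + 1) / (1 + b)) * ∫ z in quadrant a b, h z * weight m n z ≤
      ∫ z in quadrant a b, h z * weight m n z * slope (m + 2) (n + 2) c z := by
  have h1 := hh.integral_quadrant_centered_nonneg hm hn ha hb
  have h2 := hh.comp_swap.integral_quadrant_centered_nonneg hn hm hb ha
  rw [← preimage_swap_quadrant, ← setIntegral_swap, ← preimage_comp, Prod.swap_swap_eq,
    preimage_id] at h2
  simp only [Function.comp_apply, Prod.swap_swap, weight_swap, slope_swap] at h2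
  have hi := (hh.integrableOn_mul_weight hm hn).mono_set (quadrant_subset ha hb)
  have hs := fun a' b' c' => integrableOn_mul_slope a' b' c' (measurableSet_quadrant a b)
    (quadrant_subset ha hb) hi
  have h3 := add_nonneg h1 h2
  rw [← integral_add (hs _ _ _) (hs _ _ _)] at h3
  rw [← sub_nonneg, ← integral_const_mul, ← integral_sub (hs _ _ _) (hi.const_mul _)]
  refine h3.trans_eq (setIntegral_congr_fun (measurableSet_quadrant a b) fun z _ => ?_)
  simp only [slope]
  ring

/-- Replacing `h` on the quadrant by its values on the left edge only lowers the integral, which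
then factors as a positive constant times the line integral. -/
lemma integral_line_nonpos (hh : TameMonotone h) {m n : ℕ} (hm : 1 ≤ m) (hn : 1 ≤ n) {x b : ℝ}
    (hx : 0 < x) (hb : 0 ≤ b) (hQ : ∫ z in quadrant x b, h z * weight m n z ≤ 0) :
    ∫ y in Ioi b, h (x, y) * (1 / (1 + y) ^ (n + 2)) ≤ 0 := by
  have h0 : (fun z : ℝ × ℝ => h (x, z.2) * weight m n z) = fun z : ℝ × ℝ =>
      1 / (1 + z.1) ^ (m + 2) * (h (x, z.2) * (1 / (1 + z.2) ^ (n + 2))) := by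
    funext z
    simp only [weight]
    ring
  have hi : IntegrableOn (fun z : ℝ × ℝ => h (x, z.2) * weight m n z) (quadrant x b) := by
    have := (integrableOn_inv_one_add_pow m hx.le).mul_prod (hh.integrableOn_line hn hx hb)
    rw [Measure.prod_restrict] at this
    rw [h0]
    exact this
  have h1 : ∫ z in quadrant x b, h (x, z.2) * weight m n z ≤
      ∫ z in quadrant x b, h z * weight m n z := by
    refine setIntegral_mono_on hi
      ((hh.integrableOn_mul_weight hm hn).mono_set (quadrant_subset hx.le hb))
      (measurableSet_quadrant x b) fun z hz => ?_
    refine mul_le_mul_of_nonneg_right (hh.mono ⟨hz.1.le, le_rfl⟩)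
      (weight_pos (quadrant_subset hx.le hb hz)).le
  have h2 : ∫ z in quadrant x b, h (x, z.2) * weight m n z =
      1 / ((m + 1) * (1 + x) ^ (m + 1)) *
        ∫ y in Ioi b, h (x, y) * (1 / (1 + y) ^ (n + 2)) := by
    rw [← integral_inv_one_add_pow m hx.le, h0]
    exact setIntegral_prod_mul (fun x : ℝ => 1 / (1 + x) ^ (m + 2))
      (fun y => h (x, y) * (1 / (1 + y) ^ (n + 2))) (Ioi x) (Ioi b)
  have h3 : (0 : ℝ) < 1 / ((m + 1) * (1 + x) ^ (m + 1)) := by positivity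
  by_contra hcon
  have := mul_pos h3 (not_le.1 hcon)
  linarith

/-- On each vertical half-line Chebyshev bounds the integral below by a product of two nonpositive
numbers: the mean of `slope` (by `hline`) and the weighted integral of `h` (by `hQ`). -/
lemma integral_strip_nonneg (hh : TameMonotone h) {m n : ℕ} (hm : 1 ≤ m) (hn : 1 ≤ n)
    {p s c : ℝ} (hs : s ≤ p)
    (hline : ∀ x ∈ Ioc 0 s, c - (m + 2) / (1 + x) - (n + 1) / (1 + (p - x)) ≤ 0)
    (hQ : ∀ x ∈ Ioc 0 s, ∫ z in quadrant x (p - x), h z * weight m n z ≤ 0) :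
    0 ≤ ∫ z in strip p s, h z * weight m n z * slope (m + 2) (n + 2) c z := by
  have hi := integrableOn_mul_slope (m + 2) (n + 2) c (measurableSet_strip p s) (strip_subset hs)
    ((hh.integrableOn_mul_weight hm hn).mono_set (strip_subset hs))
  rw [← integral_indicator (measurableSet_strip p s), Measure.volume_eq_prod,
    integral_prod _ ((integrable_indicator_iff (measurableSet_strip p s)).2 hi)]
  refine integral_nonneg fun x => ?_
  change 0 ≤ ∫ y, (strip p s).indicator
    (fun z => h z * weight m n z * slope (m + 2) (n + 2) c z) (x, y)
  by_cases hx : x ∈ Ioc 0 s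
  · have hb : 0 ≤ p - x := by linarith [hx.2]
    have h1 := integral_line_nonpos hh hm hn hx.1 hb (hQ x hx)
    have h2 := chebyshev_Ioi n (c := c - (m + 2) / (1 + x)) hb (hh.mono_line x)
      (hh.integrableOn_line hn hx.1 hb)
    have h3 := (mul_nonneg_of_nonpos_of_nonpos (hline x hx) h1).trans h2
    have h4 := mul_nonneg (show (0 : ℝ) ≤ 1 / (1 + x) ^ (m + 2) by
      have := hx.1
      positivity) h3
    rw [← integral_const_mul, ← integral_indicator measurableSet_Ioi] at h4
    refine h4.trans_eq (integral_congr_ae (Filter.Eventually.of_forall fun y => ?_))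
    beta_reduce
    by_cases hy : p - x < y
    · rw [indicator_of_mem (show y ∈ Ioi (p - x) from hy), indicator_of_mem
        (show (x, y) ∈ strip p s from ⟨hx.1, hx.2, by simp only; linarith⟩)]
      simp only [weight, slope]
      ring
    · rw [indicator_of_notMem (show y ∉ Ioi (p - x) from hy), indicator_of_notMem]
      intro hz
      have : p < x + y := hz.2.2
      exact hy (by linarith)
  · refine (integral_eq_zero_of_ae (Filter.Eventually.of_forall fun y => ?_)).ge
    exact indicator_of_notMem (fun hz => hx ⟨hz.1, hz.2.1⟩) _

end TameMonotone

/-! ### Stochastic dominance above the line -/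

/-- The positive types with total value above `p`. -/
def upperRegion (p : ℝ) : Set (ℝ × ℝ) := {z | 0 < z.1 ∧ 0 < z.2 ∧ p < z.1 + z.2}

lemma measurableSet_upperRegion (p : ℝ) : MeasurableSet (upperRegion p) :=
  (measurableSet_lt measurable_const measurable_fst).inter
    ((measurableSet_lt measurable_const measurable_snd).inter
      (measurableSet_lt measurable_const (measurable_fst.add measurable_snd)))

lemma upperRegion_subset (p : ℝ) : upperRegion p ⊆ quadrant 0 0 := fun _ hz => ⟨hz.1, hz.2.1⟩

/-- The pieces are the quadrant with corner `(s, p - s)`, the strip to its left and the strip below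
it. The last is reflected so that one strip lemma serves both. -/
lemma integral_upperRegion_split {p s : ℝ} (hs0 : 0 ≤ s) (hs : s ≤ p) {F : ℝ × ℝ → ℝ}
    (hF : IntegrableOn F (quadrant 0 0)) :
    ∫ z in upperRegion p, F z = (∫ z in strip p s, F z) +
      (∫ z in quadrant s (p - s), F z) + ∫ z in strip p (p - s), F z.swap := by
  have hsw : ∫ z in strip p (p - s), F z.swap = ∫ z in Prod.swap ⁻¹' strip p (p - s), F z := by
    rw [← setIntegral_swap F, ← preimage_comp, Prod.swap_swap_eq, preimage_id]
  have hm3 := measurable_swap (measurableSet_strip p (p - s))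
  have e : upperRegion p =
      (strip p s ∪ quadrant s (p - s)) ∪ (Prod.swap ⁻¹' strip p (p - s)) := by
    ext ⟨x, y⟩
    simp only [upperRegion, strip, quadrant, mem_ofPred_eq, mem_union, mem_preimage, Prod.fst_swap,
      Prod.snd_swap, mem_prod, mem_Ioi]
    constructor
    · rintro ⟨h1, h2, h3⟩
      by_cases hx : x ≤ s
      · exact Or.inl (Or.inl ⟨h1, hx, h3⟩)
      · by_cases hy : y ≤ p - s
        · exact Or.inr ⟨h2, hy, by linarith⟩
        · exact Or.inl (Or.inr ⟨not_le.1 hx, not_le.1 hy⟩)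
    · rintro ((⟨h1, h2, h3⟩ | ⟨h1, h2⟩) | ⟨h1, h2, h3⟩)
      · exact ⟨h1, by linarith, h3⟩
      · exact ⟨by linarith, by linarith, by linarith⟩
      · exact ⟨by linarith, h1, by linarith⟩
  have hsub := upperRegion_subset p
  rw [e] at hsub
  have hsub1 := subset_union_left.trans hsub
  rw [hsw, e, setIntegral_union _ hm3 (hF.mono_set hsub1)
    (hF.mono_set (subset_union_right.trans hsub)), setIntegral_union _ (measurableSet_quadrant _ _)
    (hF.mono_set (subset_union_left.trans hsub1)) (hF.mono_set (subset_union_right.trans hsub1))]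
  · refine disjoint_left.2 fun z hz1 hz2 => ?_
    exact absurd hz1.2.1 (not_le.2 hz2.1)
  · refine disjoint_left.2 fun z hz1 hz2 => ?_
    have h3 : z.2 ≤ p - s := hz2.2.1
    have h4 : p < z.2 + z.1 := hz2.2.2
    rcases hz1 with hz1 | hz1
    · have h5 : z.1 ≤ s := hz1.2.1
      linarith
    · have h5 : p - s < z.2 := hz1.2
      linarith

namespace TameMonotone

variable {h : ℝ × ℝ → ℝ}

/-- `k` is the supremum of the weighted averages of `h` over quadrants with corner on the line.
Approximating the supremum avoids any continuity in `s`; the weight mass `D s ≤ 1` turns a gap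
between averages into one between integrals. -/
lemma exists_translate (hh : TameMonotone h) {m n : ℕ} (hm : 1 ≤ m) (hn : 1 ≤ n) {p : ℝ}
    (hp : 0 ≤ p) : ∃ k : ℝ,
      (∀ s ∈ Icc 0 p, ∫ z in quadrant s (p - s), (h z - k) * weight m n z ≤ 0) ∧
      ∀ ε > 0, ∃ s ∈ Icc 0 p, -ε ≤ ∫ z in quadrant s (p - s), (h z - k) * weight m n z := by
  set N : ℝ → ℝ := fun s => ∫ z in quadrant s (p - s), h z * weight m n z with hN
  set D : ℝ → ℝ := fun s => ∫ z in quadrant s (p - s), weight m n z with hD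
  have hi := hh.integrableOn_mul_weight hm hn
  have hD' : ∀ s ∈ Icc 0 p, D s =
      1 / ((m + 1) * (1 + s) ^ (m + 1)) * (1 / ((n + 1) * (1 + (p - s)) ^ (n + 1))) :=
    fun s hs => integral_weight m n hs.1 (sub_nonneg.2 hs.2)
  set d : ℝ := 1 / ((m + 1) * (1 + p) ^ (m + 1)) * (1 / ((n + 1) * (1 + p) ^ (n + 1))) with hd
  have hdpos : 0 < d := by positivity
  have hdD : ∀ s ∈ Icc 0 p, d ≤ D s := by
    intro s hs
    rw [hD' s hs]
    have h1 := hs.1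
    have h2 : 0 ≤ p - s := sub_nonneg.2 hs.2
    apply mul_le_mul _ _ (by positivity) (by positivity)
    · exact one_div_le_one_div_of_le (by positivity) (by gcongr; exact hs.2)
    · exact one_div_le_one_div_of_le (by positivity) (by gcongr; linarith)
  have hDle : ∀ s ∈ Icc 0 p, D s ≤ 1 := by
    intro s hs
    rw [hD' s hs]
    have h1 := hs.1
    have h2 : 0 ≤ p - s := sub_nonneg.2 hs.2
    refine mul_le_one₀ ?_ (by positivity) ?_
    · refine div_le_one_of_le₀ (one_le_mul_of_one_le_of_one_le (by linarith [m.cast_nonneg (α := ℝ)])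
        (one_le_pow₀ (by linarith))) (by positivity)
    · refine div_le_one_of_le₀ (one_le_mul_of_one_le_of_one_le (by linarith [n.cast_nonneg (α := ℝ)])
        (one_le_pow₀ (by linarith))) (by positivity)
  have hDpos : ∀ s ∈ Icc 0 p, 0 < D s := fun s hs => hdpos.trans_le (hdD s hs)
  have hNle : ∀ s ∈ Icc 0 p, N s ≤ ∫ z in quadrant 0 0, |h z * weight m n z| := by
    intro s hs
    have hsub := quadrant_subset hs.1 (sub_nonneg.2 hs.2)
    refine (setIntegral_mono_on (hi.mono_set hsub) (hi.mono_set hsub).abs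
      (measurableSet_quadrant _ _) fun z _ => le_abs_self _).trans ?_
    exact setIntegral_mono_set hi.abs (Filter.Eventually.of_forall fun z => abs_nonneg _)
      hsub.eventuallyLE
  have hbdd : BddAbove ((fun s => N s / D s) '' Icc 0 p) := by
    refine ⟨(∫ z in quadrant 0 0, |h z * weight m n z|) / d, ?_⟩
    rintro _ ⟨s, hs, rfl⟩
    have h0 : 0 ≤ ∫ z in quadrant 0 0, |h z * weight m n z| := integral_nonneg fun z => abs_nonneg _
    exact div_le_div₀ h0 (hNle s hs) hdpos (hdD s hs)
  have hint : ∀ k, ∀ s ∈ Icc 0 p,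
      ∫ z in quadrant s (p - s), (h z - k) * weight m n z = N s - k * D s := by
    intro k s hs
    have hsub := quadrant_subset hs.1 (sub_nonneg.2 hs.2)
    simp only [sub_mul]
    rw [integral_sub (hi.mono_set hsub)
      ((integrableOn_weight m n hs.1 (sub_nonneg.2 hs.2)).const_mul k), integral_const_mul]
  refine ⟨sSup ((fun s => N s / D s) '' Icc 0 p), fun s hs => ?_, fun ε hε => ?_⟩
  · rw [hint _ s hs, sub_nonpos, ← div_le_iff₀ (hDpos s hs)]
    exact le_csSup hbdd ⟨s, hs, rfl⟩
  · obtain ⟨_, ⟨s, hs, rfl⟩, hlt⟩ := exists_lt_of_lt_csSup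
      (Set.Nonempty.image (fun s => N s / D s) ⟨0, left_mem_Icc.2 hp⟩) (sub_lt_self _ hε)
    refine ⟨s, hs, ?_⟩
    rw [hint _ s hs]
    rw [lt_div_iff₀ (hDpos s hs)] at hlt
    nlinarith [hDle s hs]

/-- If the weighted function `slope` has zero mass above the line `x + y = p`, then its positive
part dominates its negative part there, in the sense of first-order stochastic dominance. -/
theorem integral_upperRegion_nonneg (hh : TameMonotone h) {p : ℝ} (hp3 : 0.3 ≤ p) (hp' : p ≤ 0.36)
    (h0 : ∫ z in upperRegion p, weight 4 5 z * slope 6 7 10 z = 0) :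
    0 ≤ ∫ z in upperRegion p, h z * weight 4 5 z * slope 6 7 10 z := by
  have hp : 0 ≤ p := le_trans (by norm_num) hp3
  obtain ⟨k, hk, hε⟩ := hh.exists_translate (m := 4) (n := 5) (by norm_num) (by norm_num) hp
  have hg := hh.sub_const k
  have e4 : ((4 : ℕ) : ℝ) + 2 = 6 := by norm_num
  have e5 : ((5 : ℕ) : ℝ) + 2 = 7 := by norm_num
  have e4' : ((4 : ℕ) : ℝ) + 1 = 5 := by norm_num
  have e5' : ((5 : ℕ) : ℝ) + 1 = 6 := by norm_num
  have hig := integrableOn_mul_slope 6 7 10 (measurableSet_quadrant 0 0) subset_rfl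
    (hg.integrableOn_mul_weight (m := 4) (n := 5) (by norm_num) (by norm_num))
  have hiw := integrableOn_mul_slope 6 7 10 (measurableSet_quadrant 0 0) subset_rfl
    (integrableOn_weight 4 5 le_rfl le_rfl)
  -- Subtracting the constant `k` is free because the signed density has mass zero.
  have htr : ∫ z in upperRegion p, h z * weight 4 5 z * slope 6 7 10 z =
      ∫ z in upperRegion p, (h z - k) * weight 4 5 z * slope 6 7 10 z := by
    have : ∀ z, h z * weight 4 5 z * slope 6 7 10 z =
        (h z - k) * weight 4 5 z * slope 6 7 10 z + k * (weight 4 5 z * slope 6 7 10 z) := by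
      intro z; ring
    simp only [this]
    rw [integral_add (hig.mono_set (upperRegion_subset p))
      ((hiw.mono_set (upperRegion_subset p)).const_mul k), integral_const_mul, h0]
    ring
  rw [htr]
  refine le_of_forall_pos_le_add fun ε hεpos => ?_
  -- The Chebyshev coefficient on the quadrant lies in `[0, 10]`, so an error of `ε / 10` grows to
  -- at most `ε`.
  obtain ⟨s, hs, hsε⟩ := hε (ε / 10) (by positivity)
  have hs0 : 0 ≤ s := hs.1
  have hsp : s ≤ p := hs.2
  rw [integral_upperRegion_split hs0 hsp hig]
  have h1 : 0 ≤ ∫ z in strip p s, (h z - k) * weight 4 5 z * slope 6 7 10 z := by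
    have := hg.integral_strip_nonneg (m := 4) (n := 5) (c := 10) (by norm_num) (by norm_num) hsp
    rw [e4, e5, e5'] at this
    refine this (fun x hx => ?_) fun x hx => hk x ⟨hx.1.le, hx.2.trans hsp⟩
    have hx1 := hx.1
    have hx2 : 0 ≤ p - x := by linarith [hx.2]
    -- By convexity the two fractions sum to at least `12 / (1 + p / 2)`, which exceeds 10 since `p
    -- ≤ 0.36`.
    rw [sub_sub, sub_nonpos, div_add_div _ _ (by positivity) (by positivity),
      le_div_iff₀ (by positivity)]
    nlinarith [sq_nonneg (x - (p - x))]
  have h3 : 0 ≤ ∫ z in strip p (p - s), (h z.swap - k) * weight 4 5 z.swap *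
      slope 6 7 10 z.swap := by
    have := hg.comp_swap.integral_strip_nonneg (m := 5) (n := 4) (p := p) (s := p - s) (c := 10)
      (by norm_num) (by norm_num) (by linarith)
    rw [e4, e5, e4'] at this
    simp only [weight_swap, slope_swap]
    refine this (fun x hx => ?_) fun x hx => ?_
    · have hx1 := hx.1
      have hx2 : 0 ≤ p - x := by linarith [hx.2]
      rw [sub_sub, sub_nonpos, div_add_div _ _ (by positivity) (by positivity),
        le_div_iff₀ (by positivity)]
      nlinarith [sq_nonneg (x - (p - x))]
    · have h4 := hk (p - x) ⟨by linarith [hx.2], by linarith [hx.1]⟩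
      rw [sub_sub_cancel, ← setIntegral_swap, preimage_swap_quadrant] at h4
      simpa only [weight_swap, Function.comp_apply] using h4
  have h2 : -ε ≤ ∫ z in quadrant s (p - s), (h z - k) * weight 4 5 z * slope 6 7 10 z := by
    have := hg.chebyshev_quadrant (m := 4) (n := 5) (c := 10) (by norm_num) (by norm_num) hs0
      (sub_nonneg.2 hsp)
    rw [e4, e5, e4', e5'] at this
    refine le_trans ?_ this
    have h5 : 0 ≤ p - s := sub_nonneg.2 hsp
    have h6 : 0 ≤ 5 / (1 + s) + 6 / (1 + (p - s)) := by positivity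
    -- The lower bound on `p` enters here: the sum is convex in `s`, hence largest at an endpoint,
    -- and there it is at most `5 / 1.3 + 6 < 10`.
    have h7 : 5 / (1 + s) + 6 / (1 + (p - s)) ≤ 10 := by
      rw [div_add_div _ _ (by positivity) (by positivity), div_le_iff₀ (by positivity)]
      nlinarith [mul_nonneg hs0 h5]
    nlinarith
  linarith

end TameMonotone

/-! ### Revenue as a functional of utility, by scaling -/

lemma smul_mem_quadrant {z : ℝ × ℝ} (hz : z ∈ quadrant 0 0) {s : ℝ} (hs : 0 < s) :
    s • z ∈ quadrant 0 0 := ⟨mul_pos hs hz.1, mul_pos hs hz.2⟩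

open Pointwise in
lemma smul_quadrant {s : ℝ} (hs : 0 < s) : s • quadrant 0 0 = quadrant 0 0 := by
  ext z
  rw [mem_smul_set_iff_inv_smul_mem₀ hs.ne']
  refine ⟨fun hz => ?_, fun hz => smul_mem_quadrant hz (inv_pos.2 hs)⟩
  simpa [smul_smul, hs.ne'] using smul_mem_quadrant hz hs

lemma integral_quadrant_smul (F : ℝ × ℝ → ℝ) {s : ℝ} (hs : 0 < s) :
    s ^ 2 * ∫ z in quadrant 0 0, F (s • z) = ∫ z in quadrant 0 0, F z := by
  rw [Measure.setIntegral_comp_smul_of_pos volume F (quadrant 0 0) hs, smul_quadrant hs,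
    Module.finrank_prod, Module.finrank_self, smul_eq_mul]
  have : s ^ 2 ≠ 0 := by positivity
  field_simp

lemma hasDerivAt_inv_one_add_mul_pow (k : ℕ) {s x : ℝ} (h0 : 0 < 1 + s * x) :
    HasDerivAt (fun s : ℝ => 1 / (1 + s * x) ^ (k + 2))
      (-(k + 2) * (x / (1 + s * x)) * (1 / (1 + s * x) ^ (k + 2))) s := by
  have h1 : HasDerivAt (fun s : ℝ => 1 + s * x) (1 * x) s :=
    ((hasDerivAt_id s).mul_const x).const_add 1
  have h2 := (h1.pow (k + 2)).inv (show (1 + s * x) ^ (k + 2) ≠ 0 by positivity)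
  simp only [one_div]
  refine h2.congr_deriv ?_
  simp only [Pi.pow_apply, show k + 2 - 1 = k + 1 from rfl]
  push_cast
  field_simp
  ring

lemma hasDerivAt_weight_smul (m n : ℕ) {z : ℝ × ℝ} (hz : z ∈ quadrant 0 0) {s : ℝ} (hs : 0 < s) :
    HasDerivAt (fun s : ℝ => s ^ 2 * weight m n (s • z))
      (weight m n (s • z) * (2 * s - s ^ 2 * ((m + 2) * (z.1 / (1 + s * z.1)) +
        (n + 2) * (z.2 / (1 + s * z.2))))) s := by
  have h1 : 0 < z.1 := hz.1
  have h2 : 0 < z.2 := hz.2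
  refine ((hasDerivAt_pow 2 s).mul ((hasDerivAt_inv_one_add_mul_pow m
    (by positivity)).mul (hasDerivAt_inv_one_add_mul_pow n (by positivity)))).congr_deriv ?_
  simp only [weight, Prod.smul_fst, Prod.smul_snd, smul_eq_mul, Pi.mul_apply]
  push_cast
  ring

lemma weight_smul_le (m n : ℕ) {z : ℝ × ℝ} (hz : z ∈ quadrant 0 0) {s : ℝ} (hs : 1 / 2 ≤ s) :
    weight m n (s • z) ≤ 2 ^ (m + 2) * 2 ^ (n + 2) * weight m n z := by
  have aux : ∀ (k : ℕ) (x : ℝ), 0 < x → 1 / (1 + s * x) ^ k ≤ 2 ^ k * (1 / (1 + x) ^ k) := by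
    intro k x hx
    have h1 : (1 + x) / 2 ≤ 1 + s * x := by nlinarith
    rw [show (2 : ℝ) ^ k * (1 / (1 + x) ^ k) = 1 / ((1 + x) / 2) ^ k by
      rw [div_pow]; field_simp]
    exact one_div_le_one_div_of_le (by positivity) (pow_le_pow_left₀ (by positivity) h1 k)
  have h1 : 0 < z.1 := hz.1
  have h2 : 0 < z.2 := hz.2
  calc weight m n (s • z) ≤ 2 ^ (m + 2) * (1 / (1 + z.1) ^ (m + 2)) *
        (2 ^ (n + 2) * (1 / (1 + z.2) ^ (n + 2))) :=
      mul_le_mul (aux _ _ h1) (aux _ _ h2) (by simp; positivity) (by positivity)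
    _ = _ := by unfold weight; ring

/-- The scaling parameter sits in the smooth weight, so `u` need only be measurable with controlled
growth. Restricting to `1/2 < s < 2` keeps the scaled weight within a constant multiple of the
original, which gives the dominating function. -/
lemma hasDerivAt_integral_scaled {m n : ℕ} (hm : 1 ≤ m) (hn : 1 ≤ n) {u : ℝ × ℝ → ℝ} {C : ℝ}
    (hC : 0 ≤ C) (hu : Measurable u)
    (hb : ∀ z ∈ quadrant 0 0, |u z| ≤ C * ((1 + z.1) * (1 + z.2))) :
    HasDerivAt (fun s : ℝ => ∫ z in quadrant 0 0, u z * (s ^ 2 * weight m n (s • z)))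
      (∫ z in quadrant 0 0, u z * (weight m n z * (2 - ((m + 2) * (z.1 / (1 + z.1)) +
        (n + 2) * (z.2 / (1 + z.2)))))) 1 := by
  have hw := measurable_weight m n
  set K : ℝ := 2 ^ (m + 2) * 2 ^ (n + 2) * (2 * (2 + ((m + 2) + (n + 2)))) with hK
  have hK0 : 0 ≤ K := by positivity
  have h := hasDerivAt_integral_of_dominated_loc_of_deriv_le (𝕜 := ℝ)
    (μ := volume.restrict (quadrant 0 0))
    (F := fun s z => u z * (s ^ 2 * weight m n (s • z)))
    (F' := fun s z => u z * (weight m n (s • z) * (2 * s - s ^ 2 *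
      ((m + 2) * (z.1 / (1 + s * z.1)) + (n + 2) * (z.2 / (1 + s * z.2))))))
    (x₀ := 1) (s := Ioo (1 / 2) 2)
    (bound := fun z => (C * K * ((1 + z.1) * (1 + z.2))) * weight m n z)
    (Ioo_mem_nhds (by norm_num) (by norm_num))
    (Filter.Eventually.of_forall fun s => Measurable.aestronglyMeasurable (by fun_prop))
    ?_ (Measurable.aestronglyMeasurable (by fun_prop)) ?_ ?_ ?_
  · simpa using h.2
  · have := integrableOn_mul_weight_of_bound hm hn hu.aestronglyMeasurable hb
    simp only [one_pow, one_mul, one_smul]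
    exact this
  · refine (ae_restrict_iff' (measurableSet_quadrant _ _)).2
      (Filter.Eventually.of_forall fun z hz s hs => ?_)
    have h1 : 0 < z.1 := hz.1
    have h2 : 0 < z.2 := hz.2
    have hs0 : 0 < s := by linarith [hs.1]
    have aux : ∀ x : ℝ, 0 < x → 0 ≤ s ^ 2 * (x / (1 + s * x)) ∧ s ^ 2 * (x / (1 + s * x)) ≤ 2 := by
      intro x hx
      refine ⟨by positivity, ?_⟩
      rw [← mul_div_assoc, div_le_iff₀ (by positivity)]
      nlinarith [mul_pos hs0 hx, hs.2]
    obtain ⟨a1, a2⟩ := aux z.1 h1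
    obtain ⟨b1, b2⟩ := aux z.2 h2
    have h3 : |2 * s - s ^ 2 * ((m + 2) * (z.1 / (1 + s * z.1)) +
        (n + 2) * (z.2 / (1 + s * z.2)))| ≤ 2 * (2 + (((m : ℝ) + 2) + (n + 2))) := by
      have e : 2 * s - s ^ 2 * ((m + 2) * (z.1 / (1 + s * z.1)) +
        (n + 2) * (z.2 / (1 + s * z.2))) = 2 * s - (m + 2) * (s ^ 2 * (z.1 / (1 + s * z.1))) -
          (n + 2) * (s ^ 2 * (z.2 / (1 + s * z.2))) := by ring
      have hm0 : (0 : ℝ) ≤ m + 2 := by positivity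
      have hn0 : (0 : ℝ) ≤ n + 2 := by positivity
      have c1 := mul_le_mul_of_nonneg_left a2 hm0
      have c2 := mul_le_mul_of_nonneg_left b2 hn0
      have c3 := mul_nonneg hm0 a1
      have c4 := mul_nonneg hn0 b1
      rw [e, abs_le]
      constructor <;> linarith [hs.2]
    have hwp := weight_pos (m := m) (n := n) (smul_mem_quadrant hz hs0)
    rw [Real.norm_eq_abs, abs_mul, abs_mul, abs_of_pos hwp]
    calc _ ≤ C * ((1 + z.1) * (1 + z.2)) *
          ((2 ^ (m + 2) * 2 ^ (n + 2) * weight m n z) * (2 * (2 + ((m + 2) + (n + 2))))) := by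
          refine mul_le_mul (hb z hz) (mul_le_mul (weight_smul_le m n hz hs.1.le) h3 (abs_nonneg _) ?_)
            (by positivity) (by positivity)
          exact mul_nonneg (by positivity) (weight_pos hz).le
      _ = _ := by rw [hK]; ring
  · refine integrableOn_mul_weight_of_bound (C := C * K) hm hn
      (Measurable.aestronglyMeasurable (by fun_prop)) fun z hz => le_of_eq (abs_of_nonneg ?_)
    have h1 : 0 < z.1 := hz.1
    have h2 : 0 < z.2 := hz.2
    positivity
  · refine (ae_restrict_iff' (measurableSet_quadrant _ _)).2
      (Filter.Eventually.of_forall fun z hz s hs => ?_)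
    exact (hasDerivAt_weight_smul m n hz (by linarith [hs.1])).const_mul (u z)

/-- Revenue as a linear functional of the utility `u`: if `q z` is a subgradient of `u` at `z` in
the radial direction, then scaling the types shows that the payment `q - u` integrates like `u`
against the transformed density. -/
theorem integral_payment {m n : ℕ} (hm : 1 ≤ m) (hn : 1 ≤ n) {u q : ℝ × ℝ → ℝ} {C : ℝ}
    (hC : 0 ≤ C) (hu : Measurable u)
    (hub : ∀ z ∈ quadrant 0 0, |u z| ≤ C * ((1 + z.1) * (1 + z.2)))
    (hq : AEStronglyMeasurable q (volume.restrict (quadrant 0 0)))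
    (hqb : ∀ z ∈ quadrant 0 0, |q z| ≤ C * ((1 + z.1) * (1 + z.2)))
    (hsub : ∀ z ∈ quadrant 0 0, ∀ t > 0, u z + (t - 1) * q z ≤ u (t • z)) :
    ∫ z in quadrant 0 0, (q z - u z) * weight m n z =
      ∫ z in quadrant 0 0, u z * weight m n z * slope (m + 2) (n + 2) (m + n + 1) z := by
  have hui := integrableOn_mul_weight_of_bound hm hn hu.aestronglyMeasurable hub
  have hqi := integrableOn_mul_weight_of_bound hm hn hq hqb
  have hw := measurable_weight m n
  set P := ∫ z in quadrant 0 0, q z * weight m n z with hP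
  set J : ℝ → ℝ := fun s => ∫ z in quadrant 0 0, u z * (s ^ 2 * weight m n (s • z)) with hJ
  have hJ1 : J 1 = ∫ z in quadrant 0 0, u z * weight m n z := by simp [hJ]
  have hJs : ∀ s : ℝ, 0 < s → J s = ∫ z in quadrant 0 0, u (s⁻¹ • z) * weight m n z := by
    intro s hs
    rw [← integral_quadrant_smul _ hs, ← integral_const_mul]
    refine integral_congr_ae (Filter.Eventually.of_forall fun z => ?_)
    simp only [smul_smul, inv_mul_cancel₀ hs.ne', one_smul]
    ring
  -- The change of variables moves the scaling onto `u`; this is the radial subgradient inequality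
  -- at `t = s⁻¹`, integrated.
  have hmin : ∀ s : ℝ, 0 < s → J 1 + (s⁻¹ - 1) * P ≤ J s := by
    intro s hs
    rw [hJs s hs, hJ1, hP, ← integral_const_mul, ← integral_add hui (hqi.const_mul _)]
    refine setIntegral_mono_on (hui.add (hqi.const_mul _)) ?_ (measurableSet_quadrant _ _)
      fun z hz => ?_
    · refine integrableOn_mul_weight_of_bound (C := C * (1 + s⁻¹) ^ 2) hm hn
        (Measurable.aestronglyMeasurable (by fun_prop)) fun z hz => ?_
      refine (hub _ (smul_mem_quadrant hz (inv_pos.2 hs))).trans ?_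
      rw [mul_assoc]
      refine mul_le_mul_of_nonneg_left ?_ hC
      have h1 : 0 < z.1 := hz.1
      have h2 : 0 < z.2 := hz.2
      have h3 : 0 < s⁻¹ := inv_pos.2 hs
      simp only [Prod.smul_fst, Prod.smul_snd, smul_eq_mul]
      calc (1 + s⁻¹ * z.1) * (1 + s⁻¹ * z.2) ≤ ((1 + s⁻¹) * (1 + z.1)) * ((1 + s⁻¹) * (1 + z.2)) :=
            mul_le_mul (by nlinarith) (by nlinarith) (by positivity) (by positivity)
        _ = _ := by ring
    · have := mul_le_mul_of_nonneg_right (hsub z hz s⁻¹ (inv_pos.2 hs)) (weight_pos (m := m) (n := n) hz).le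
      linarith
  -- Stationarity at 1 gives `P = -J'(1)`. This replaces integration by parts and needs no
  -- derivative of `u`.
  have hlm : IsLocalMin (fun s => J s - P * s⁻¹) 1 := by
    filter_upwards [lt_mem_nhds (zero_lt_one' ℝ)] with s hs
    have := hmin s hs
    simp only [inv_one]
    linarith
  have hd := hlm.hasDerivAt_eq_zero ((hasDerivAt_integral_scaled hm hn hC hu hub).sub
    ((hasDerivAt_inv one_ne_zero).const_mul P))
  have hsi := integrableOn_mul_slope (m + 2) (n + 2) (m + n + 1) (measurableSet_quadrant 0 0)
    subset_rfl hui
  have hd2 : ∫ z in quadrant 0 0, u z * (weight m n z * (2 - ((m + 2) * (z.1 / (1 + z.1)) +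
        (n + 2) * (z.2 / (1 + z.2))))) = -(∫ z in quadrant 0 0, u z * weight m n z) -
        ∫ z in quadrant 0 0, u z * weight m n z * slope (m + 2) (n + 2) (m + n + 1) z := by
    rw [← integral_neg]
    refine Eq.trans ?_ (integral_sub hui.neg hsi)
    refine setIntegral_congr_fun (measurableSet_quadrant 0 0) fun z hz => ?_
    have h1 : 0 < z.1 := hz.1
    have h2 : 0 < z.2 := hz.2
    have e1 : z.1 / (1 + z.1) = 1 - 1 / (1 + z.1) := by field_simp; ring
    have e2 : z.2 / (1 + z.2) = 1 - 1 / (1 + z.2) := by field_simp; ring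
    simp only [slope, e1, e2]
    ring
  rw [hd2] at hd
  simp only [sub_mul]
  rw [integral_sub hqi hui, ← hP]
  norm_num at hd
  linarith

/-! ### Numerical location of the critical price -/

/-- With `T` the binomial series cut after `v ^ 4`, `1 - (1 - v) ^ 6 * T` is `v ^ 5` times the
polynomial in `hR`. The next series coefficient is 252; raising it to 300 absorbs the whole tail for
`v ≤ 0.024`. The seventh power is treated alike, with 462 raised to 600. -/
lemma inv_one_sub_pow_six_bounds {v : ℝ} (hv : 0 ≤ v) (hv' : v ≤ 0.024) :
    1 + 6 * v + 21 * v ^ 2 + 56 * v ^ 3 + 126 * v ^ 4 ≤ 1 / (1 - v) ^ 6 ∧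
    1 / (1 - v) ^ 6 ≤ 1 + 6 * v + 21 * v ^ 2 + 56 * v ^ 3 + 126 * v ^ 4 + 300 * v ^ 5 := by
  have h1 : 0 < 1 - v := by linarith
  have h2 := one_add_mul_le_pow (a := -v) (by linarith) 6
  rw [← sub_eq_add_neg] at h2
  norm_num at h2
  have h5 : 0 ≤ v ^ 5 := by positivity
  have hR : 0 ≤ 252 - 1050 * v + 1800 * v ^ 2 - 1575 * v ^ 3 + 700 * v ^ 4 - 126 * v ^ 5 := by
    nlinarith [pow_nonneg hv 2, pow_nonneg hv 3, pow_nonneg hv 4,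
      mul_nonneg (pow_nonneg hv 2) (sub_nonneg.2 hv'), mul_nonneg (pow_nonneg hv 4) (sub_nonneg.2 hv')]
  have hR' : 252 - 1050 * v + 1800 * v ^ 2 - 1575 * v ^ 3 + 700 * v ^ 4 - 126 * v ^ 5 ≤ 254 := by
    nlinarith [pow_nonneg hv 3, pow_nonneg hv 5, mul_nonneg hv (sub_nonneg.2 hv'),
      mul_nonneg (pow_nonneg hv 3) (sub_nonneg.2 hv')]
  constructor
  · rw [le_div_iff₀ (by positivity)]
    nlinarith [mul_nonneg h5 hR]
  · rw [div_le_iff₀ (by positivity)]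
    have : 0 ≤ v ^ 5 * (300 * (1 - v) ^ 6 -
      (252 - 1050 * v + 1800 * v ^ 2 - 1575 * v ^ 3 + 700 * v ^ 4 - 126 * v ^ 5)) :=
      mul_nonneg h5 (by nlinarith)
    nlinarith

lemma inv_one_sub_pow_seven_bounds {v : ℝ} (hv : 0 ≤ v) (hv' : v ≤ 0.024) :
    1 + 7 * v + 28 * v ^ 2 + 84 * v ^ 3 + 210 * v ^ 4 ≤ 1 / (1 - v) ^ 7 ∧
    1 / (1 - v) ^ 7 ≤ 1 + 7 * v + 28 * v ^ 2 + 84 * v ^ 3 + 210 * v ^ 4 + 600 * v ^ 5 := by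
  have h1 : 0 < 1 - v := by linarith
  have h2 := one_add_mul_le_pow (a := -v) (by linarith) 7
  rw [← sub_eq_add_neg] at h2
  norm_num at h2
  have h5 : 0 ≤ v ^ 5 := by positivity
  have e : (462 - 2310 * v + 4950 * v ^ 2 - 5775 * v ^ 3 + 3850 * v ^ 4 - 1386 * v ^ 5 +
      210 * v ^ 6) = 462 - 2310 * v + v ^ 2 * (4950 - 5775 * v) + v ^ 4 * (3850 - 1386 * v) +
      210 * v ^ 6 := by ring
  have t1 : 0 ≤ v ^ 2 * (4950 - 5775 * v) := mul_nonneg (by positivity) (by linarith)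
  have t2 : 0 ≤ v ^ 4 * (3850 - 1386 * v) := mul_nonneg (by positivity) (by linarith)
  have t3 : 0 ≤ v ^ 6 := by positivity
  have hR : 0 ≤ 462 - 2310 * v + 4950 * v ^ 2 - 5775 * v ^ 3 + 3850 * v ^ 4 - 1386 * v ^ 5 +
      210 * v ^ 6 := by
    rw [e]
    linarith
  have hR' : 462 - 2310 * v + 4950 * v ^ 2 - 5775 * v ^ 3 + 3850 * v ^ 4 - 1386 * v ^ 5 +
      210 * v ^ 6 ≤ 470 := by
    have s2 : v ^ 2 ≤ 0.024 ^ 2 := pow_le_pow_left₀ hv hv' 2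
    have s4 : v ^ 4 ≤ 0.024 ^ 4 := pow_le_pow_left₀ hv hv' 4
    have s6 : v ^ 6 ≤ 0.024 ^ 6 := pow_le_pow_left₀ hv hv' 6
    have := pow_nonneg hv 3
    have := pow_nonneg hv 5
    norm_num at s2 s4 s6
    linarith
  constructor
  · rw [le_div_iff₀ (by positivity)]
    nlinarith [mul_nonneg h5 hR]
  · rw [div_le_iff₀ (by positivity)]
    have : 0 ≤ v ^ 5 * (600 * (1 - v) ^ 7 -
      (462 - 2310 * v + 4950 * v ^ 2 - 5775 * v ^ 3 + 3850 * v ^ 4 - 1386 * v ^ 5 + 210 * v ^ 6)) :=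
      mul_nonneg h5 (by nlinarith)
    nlinarith

/-- The squared relative distance of `x` from the midpoint of `[0, p]`. -/
def relDev (p x : ℝ) : ℝ := ((x - p / 2) / (1 + p / 2)) ^ 2

lemma integral_relDev_pow (p : ℝ) (k : ℕ) :
    ∫ x in (0)..p, relDev p x ^ k = p * ((p / 2 / (1 + p / 2)) ^ 2) ^ k / (2 * k + 1) := by
  have h : ∀ x, relDev p x ^ k = (1 / (1 + p / 2)) ^ (2 * k) * (x - p / 2) ^ (2 * k) := by
    intro x
    rw [relDev, ← pow_mul, ← mul_pow, div_eq_mul_one_div, mul_comm]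
  simp only [h]
  rw [intervalIntegral.integral_const_mul,
    intervalIntegral.integral_comp_sub_right (fun x => x ^ (2 * k)), integral_pow]
  rw [show (0 - p / 2 : ℝ) = -(p / 2) by ring, show p - p / 2 = p / 2 by ring,
    Odd.neg_pow ⟨k, rfl⟩, ← pow_mul, div_pow, div_pow (p / 2), one_pow]
  push_cast
  ring

lemma integral_relDev_poly (p c₀ c₁ c₂ c₃ c₄ c₅ : ℝ) :
    ∫ x in (0)..p, (c₀ + c₁ * relDev p x + c₂ * relDev p x ^ 2 + c₃ * relDev p x ^ 3 +
      c₄ * relDev p x ^ 4 + c₅ * relDev p x ^ 5) =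
    p * (c₀ + c₁ * (p / 2 / (1 + p / 2)) ^ 2 / 3 + c₂ * (p / 2 / (1 + p / 2)) ^ 4 / 5 +
      c₃ * (p / 2 / (1 + p / 2)) ^ 6 / 7 + c₄ * (p / 2 / (1 + p / 2)) ^ 8 / 9 +
      c₅ * (p / 2 / (1 + p / 2)) ^ 10 / 11) := by
  have hc : Continuous (relDev p) := by unfold relDev; fun_prop
  have hi : ∀ (c : ℝ) (k : ℕ), IntervalIntegrable (fun x => c * relDev p x ^ k) volume 0 p :=
    fun c k => ((hc.pow k).const_mul c).intervalIntegrable 0 p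
  have h1 := hi c₁ 1
  simp only [pow_one] at h1
  have e1 := integral_relDev_pow p 1
  simp only [pow_one] at e1
  rw [intervalIntegral.integral_add ((((intervalIntegrable_const.add h1).add (hi c₂ 2)).add
      (hi c₃ 3)).add (hi c₄ 4)) (hi c₅ 5),
    intervalIntegral.integral_add (((intervalIntegrable_const.add h1).add (hi c₂ 2)).add
      (hi c₃ 3)) (hi c₄ 4),
    intervalIntegral.integral_add ((intervalIntegrable_const.add h1).add (hi c₂ 2)) (hi c₃ 3),
    intervalIntegral.integral_add (intervalIntegrable_const.add h1) (hi c₂ 2),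
    intervalIntegral.integral_add intervalIntegrable_const h1]
  simp only [intervalIntegral.integral_const_mul, intervalIntegral.integral_const,
    integral_relDev_pow, e1, smul_eq_mul]
  push_cast
  ring

/-- The density of the mass of `weight * slope` above the line `x + y = p`, over `0 ≤ x ≤ p`. -/
def edgeDensity (p x : ℝ) : ℝ :=
  5 / 3 / ((1 + x) * (1 + (p - x))) ^ 6 - (2 + p) / ((1 + x) * (1 + (p - x))) ^ 7

/-- Completing the square gives `(1 + x) * (1 + (p - x)) = (1 + p / 2) ^ 2 * (1 - relDev p x)`. Then
`x` enters only through `relDev`, whose powers integrate in closed form. -/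
lemma edgeDensity_eq {p x : ℝ} (hp : 0 ≤ p) : edgeDensity p x =
    5 / 3 / (1 + p / 2) ^ 12 * (1 / (1 - relDev p x) ^ 6) -
      (2 + p) / (1 + p / 2) ^ 14 * (1 / (1 - relDev p x) ^ 7) := by
  have h : (1 + x) * (1 + (p - x)) = (1 + p / 2) ^ 2 * (1 - relDev p x) := by
    unfold relDev
    field_simp
    ring
  rw [edgeDensity, h, mul_pow, mul_pow, ← pow_mul, ← pow_mul]
  simp only [div_eq_mul_inv, mul_inv, one_mul]
  ring

lemma relDev_mem {p x : ℝ} (hp' : p ≤ 0.36) (hx : x ∈ Icc 0 p) :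
    0 ≤ relDev p x ∧ relDev p x ≤ 0.024 := by
  have hp : 0 ≤ p := hx.1.trans hx.2
  refine ⟨sq_nonneg _, ?_⟩
  have h1 : |(x - p / 2) / (1 + p / 2)| ≤ 0.1527 := by
    rw [abs_div, abs_of_pos (show 0 < 1 + p / 2 by linarith), div_le_iff₀ (by linarith), abs_le]
    constructor <;> linarith [hx.1, hx.2]
  rw [relDev, ← sq_abs]
  exact (pow_le_pow_left₀ (abs_nonneg _) h1 2).trans (by norm_num)

lemma continuousOn_edgeDensity (p : ℝ) : ContinuousOn (edgeDensity p) (Icc 0 p) := by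
  have h : ∀ x ∈ Icc 0 p, (1 + x) * (1 + (p - x)) ≠ 0 := fun x hx =>
    (mul_pos (by linarith [hx.1]) (by linarith [hx.2])).ne'
  unfold edgeDensity
  refine ContinuousOn.sub ?_ ?_ <;>
  exact ContinuousOn.div (by fun_prop) (by fun_prop) fun x hx => pow_ne_zero _ (h x hx)

/-- The mass of `weight * slope` above the line `x + y = p`. -/
def upperMass (p : ℝ) : ℝ :=
  (∫ x in (0)..p, edgeDensity p x) + (4 - 5 / (1 + p)) / (30 * (1 + p) ^ 5)

/-- The sixth power is bounded above and the seventh, which enters negatively, below; what remains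
is rational arithmetic. `upperMass_pos` exchanges the two bounds. -/
lemma upperMass_neg : upperMass 0.357245 < 0 := by
  set p : ℝ := 0.357245 with hp
  have hp0 : 0 ≤ p := by norm_num [hp]
  set A := 5 / 3 / (1 + p / 2) ^ 12 with hA
  set B := (2 + p) / (1 + p / 2) ^ 14 with hB
  have hA0 : 0 ≤ A := by positivity
  have hB0 : 0 ≤ B := by positivity
  have hle : ∫ x in (0)..p, edgeDensity p x ≤ ∫ x in (0)..p, ((A - B) +
      (6 * A - 7 * B) * relDev p x + (21 * A - 28 * B) * relDev p x ^ 2 +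
      (56 * A - 84 * B) * relDev p x ^ 3 + (126 * A - 210 * B) * relDev p x ^ 4 +
      (300 * A) * relDev p x ^ 5) := by
    refine intervalIntegral.integral_mono_on hp0
      ((continuousOn_edgeDensity p).intervalIntegrable_of_Icc hp0)
      (Continuous.intervalIntegrable (by unfold relDev; fun_prop) _ _) fun x hx => ?_
    obtain ⟨h1, h2⟩ := relDev_mem (by norm_num [hp]) hx
    rw [edgeDensity_eq hp0]
    have h3 := mul_le_mul_of_nonneg_left (inv_one_sub_pow_six_bounds h1 h2).2 hA0
    have h4 := mul_le_mul_of_nonneg_left (inv_one_sub_pow_seven_bounds h1 h2).1 hB0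
    linarith
  rw [integral_relDev_poly] at hle
  unfold upperMass
  refine lt_of_le_of_lt (add_le_add_left hle _) ?_
  rw [hA, hB, hp]
  norm_num

lemma upperMass_pos : 0 < upperMass 0.357255 := by
  set p : ℝ := 0.357255 with hp
  have hp0 : 0 ≤ p := by norm_num [hp]
  set A := 5 / 3 / (1 + p / 2) ^ 12 with hA
  set B := (2 + p) / (1 + p / 2) ^ 14 with hB
  have hA0 : 0 ≤ A := by positivity
  have hB0 : 0 ≤ B := by positivity
  have hle : ∫ x in (0)..p, ((A - B) +
      (6 * A - 7 * B) * relDev p x + (21 * A - 28 * B) * relDev p x ^ 2 +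
      (56 * A - 84 * B) * relDev p x ^ 3 + (126 * A - 210 * B) * relDev p x ^ 4 +
      (-600 * B) * relDev p x ^ 5) ≤ ∫ x in (0)..p, edgeDensity p x := by
    refine intervalIntegral.integral_mono_on hp0
      (Continuous.intervalIntegrable (by unfold relDev; fun_prop) _ _)
      ((continuousOn_edgeDensity p).intervalIntegrable_of_Icc hp0) fun x hx => ?_
    obtain ⟨h1, h2⟩ := relDev_mem (by norm_num [hp]) hx
    rw [edgeDensity_eq hp0]
    have h3 := mul_le_mul_of_nonneg_left (inv_one_sub_pow_six_bounds h1 h2).1 hA0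
    have h4 := mul_le_mul_of_nonneg_left (inv_one_sub_pow_seven_bounds h1 h2).2 hB0
    linarith
  rw [integral_relDev_poly] at hle
  unfold upperMass
  refine lt_of_lt_of_le ?_ (add_le_add_left hle _)
  rw [hA, hB, hp]
  norm_num

lemma continuousOn_upperMass : ContinuousOn upperMass (Ici 0) := by
  -- Clamping at 0 keeps the denominators away from zero for all `p` and `x`, as the global
  -- parametric continuity lemma requires; nothing changes for `0 ≤ x ≤ p`.
  have h1 : Continuous fun p : ℝ => ∫ x in (0)..p,
      (5 / 3 / ((1 + max x 0) * (1 + max (p - x) 0)) ^ 6 -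
        (2 + p) / ((1 + max x 0) * (1 + max (p - x) 0)) ^ 7) := by
    refine intervalIntegral.continuous_parametric_intervalIntegral_of_continuous ?_ continuous_id
    have h : ∀ z : ℝ × ℝ, (1 + max z.2 0) * (1 + max (z.1 - z.2) 0) ≠ 0 := fun z => by positivity
    refine Continuous.sub ?_ ?_ <;>
    exact Continuous.div (by fun_prop) (by fun_prop) fun z => pow_ne_zero _ (h z)
  have h2 : ContinuousOn (fun p : ℝ => (4 - 5 / (1 + p)) / (30 * (1 + p) ^ 5)) (Ici 0) := by
    have h : ∀ p ∈ Ici (0 : ℝ), 0 < 1 + p := fun p hp => by linarith [mem_Ici.1 hp]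
    refine ContinuousOn.div (continuousOn_const.sub (continuousOn_const.div (by fun_prop)
      fun p hp => (h p hp).ne')) (by fun_prop) fun p hp => ?_
    have := h p hp
    positivity
  refine (h1.continuousOn.add h2).congr fun p hp => ?_
  rw [upperMass]
  congr 1
  refine intervalIntegral.integral_congr fun x hx => ?_
  rw [uIcc_of_le hp] at hx
  simp only [edgeDensity, max_eq_left hx.1, max_eq_left (sub_nonneg.2 hx.2)]

lemma exists_upperMass_eq_zero : ∃ p ∈ Icc (0.357245 : ℝ) 0.357255, upperMass p = 0 :=
  intermediate_value_Icc (by norm_num)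
    (continuousOn_upperMass.mono fun _ hp => mem_Ici.2 (le_trans (by norm_num) hp.1))
    ⟨upperMass_neg.le, upperMass_pos.le⟩

lemma integral_weight_mul_slope_quadrant {a : ℝ} (ha : 0 ≤ a) :
    ∫ z in quadrant a 0, weight 4 5 z * slope 6 7 10 z =
      (4 - 5 / (1 + a)) / (30 * (1 + a) ^ 5) := by
  have h : ∀ z ∈ quadrant a 0, weight 4 5 z * slope 6 7 10 z =
      10 * weight 4 5 z - 6 * weight 5 5 z - 7 * weight 4 6 z := by
    intro z hz
    have h1 : 0 < z.1 := ha.trans_lt hz.1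
    have h2 : 0 < z.2 := hz.2
    simp only [weight, slope]
    field_simp
    ring
  have hi := fun m n => integrableOn_weight m n ha le_rfl
  have hs : IntegrableOn (fun z => 10 * weight 4 5 z - 6 * weight 5 5 z) (quadrant a 0) :=
    ((hi 4 5).const_mul _).sub ((hi 5 5).const_mul _)
  rw [setIntegral_congr_fun (measurableSet_quadrant a 0) h, integral_sub
    hs ((hi 4 6).const_mul _), integral_sub
    ((hi 4 5).const_mul _) ((hi 5 5).const_mul _), integral_const_mul, integral_const_mul,
    integral_const_mul, integral_weight _ _ ha le_rfl, integral_weight _ _ ha le_rfl,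
    integral_weight _ _ ha le_rfl]
  have : 0 < 1 + a := by linarith
  norm_num
  field_simp
  ring

lemma integral_inv_one_add_pow_mul_affine (n : ℕ) {b c : ℝ} (hb : 0 ≤ b) :
    ∫ y in Ioi b, 1 / (1 + y) ^ (n + 2) * (c - (n + 2) / (1 + y)) =
      (c - (n + 1) / (1 + b)) / ((n + 1) * (1 + b) ^ (n + 1)) := by
  have h := integral_inv_one_add_pow_centered n hb
  have h2 : ∀ y : ℝ, 1 / (1 + y) ^ (n + 2) * (c - (n + 2) / (1 + y)) =
      (c - (n + 1) / (1 + b)) * (1 / (1 + y) ^ (n + 2)) +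
        1 / (1 + y) ^ (n + 2) * ((n + 1) / (1 + b) - (n + 2) / (1 + y)) := by
    intro y; ring
  simp only [h2]
  rw [integral_add ((integrableOn_inv_one_add_pow n hb).const_mul _)
    (integrableOn_mul_affine_inv hb (integrableOn_inv_one_add_pow n hb)), h, integral_const_mul,
    integral_inv_one_add_pow n hb]
  ring

lemma integral_weight_mul_slope_strip {p : ℝ} (hp : 0 ≤ p) :
    ∫ z in strip p p, weight 4 5 z * slope 6 7 10 z = ∫ x in (0)..p, edgeDensity p x := by
  have hi := integrableOn_mul_slope 6 7 10 (measurableSet_strip p p) (strip_subset le_rfl)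
    ((integrableOn_weight 4 5 le_rfl le_rfl).mono_set (strip_subset le_rfl))
  rw [← integral_indicator (measurableSet_strip p p), Measure.volume_eq_prod,
    integral_prod _ ((integrable_indicator_iff (measurableSet_strip p p)).2 hi),
    intervalIntegral.integral_of_le hp, ← integral_indicator measurableSet_Ioc]
  refine integral_congr_ae (Filter.Eventually.of_forall fun x => ?_)
  by_cases hx : x ∈ Ioc 0 p
  · have hb : 0 ≤ p - x := by linarith [hx.2]
    have hx0 := hx.1
    have h2 := integral_inv_one_add_pow_mul_affine 5 (c := 10 - 6 / (1 + x)) hb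
    -- The numerators agree because averaging `7 / (1 + y)` lowers 7 to 6, so the sum of the
    -- fractions is `6 * (2 + p)` over the product `(1 + x) * (1 + (p - x))`.
    have e : edgeDensity p x = 1 / (1 + x) ^ 6 * ((10 - 6 / (1 + x) - 6 / (1 + (p - x))) /
        (6 * (1 + (p - x)) ^ 6)) := by
      unfold edgeDensity
      have h3 : 0 < 1 + (p - x) := by linarith
      obtain ⟨y, hy⟩ : ∃ y, y = p - x := ⟨_, rfl⟩
      have hpx : p = x + y := by rw [hy]; ring
      rw [← hy] at h3 ⊢
      rw [hpx]
      field_simp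
      ring
    norm_num at h2
    rw [indicator_of_mem hx, e]
    norm_num
    rw [← h2, ← integral_const_mul, ← integral_indicator measurableSet_Ioi]
    refine integral_congr_ae (Filter.Eventually.of_forall fun y => ?_)
    beta_reduce
    by_cases hy : p - x < y
    · rw [indicator_of_mem (show y ∈ Ioi (p - x) from hy), indicator_of_mem
        (show (x, y) ∈ strip p p from ⟨hx.1, hx.2, by simp only; linarith⟩)]
      simp only [weight, slope]
      norm_num
      ring
    · rw [indicator_of_notMem (show y ∉ Ioi (p - x) from hy), indicator_of_notMem]
      intro hz
      have : p < x + y := hz.2.2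
      exact hy (by linarith)
  · rw [indicator_of_notMem hx]
    refine integral_eq_zero_of_ae (Filter.Eventually.of_forall fun y => ?_)
    exact indicator_of_notMem (fun hz => hx ⟨hz.1, hz.2.1⟩) _

lemma integral_upperRegion_eq {p : ℝ} (hp : 0 ≤ p) :
    ∫ z in upperRegion p, weight 4 5 z * slope 6 7 10 z = upperMass p := by
  have hi := integrableOn_mul_slope 6 7 10 (measurableSet_quadrant 0 0) subset_rfl
    (integrableOn_weight 4 5 le_rfl le_rfl)
  have he : strip p (p - p) = ∅ := by
    refine eq_empty_of_forall_notMem fun z hz => ?_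
    have h1 := hz.1
    have h2 := hz.2.1
    linarith
  rw [integral_upperRegion_split hp le_rfl hi, he, setIntegral_empty, add_zero, sub_self,
    integral_weight_mul_slope_strip hp, integral_weight_mul_slope_quadrant hp, upperMass]

/-! ### Transfer to the plane, and the critical price equation -/

lemma ae_fst_ne_zero_and_snd_ne_zero : ∀ᵐ z : ℝ × ℝ, z.1 ≠ 0 ∧ z.2 ≠ 0 := by
  have h : ∀ᵐ x : ℝ, x ≠ 0 := Measure.ae_ne volume 0
  exact (Measure.quasiMeasurePreserving_fst.ae h).and (Measure.quasiMeasurePreserving_snd.ae h)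

lemma pair_mem_typeSpace_iff {z : ℝ × ℝ} : ![z.1, z.2] ∈ typeSpace 2 ↔ 0 ≤ z.1 ∧ 0 ≤ z.2 := by
  simp [typeSpace, Pi.le_def, Fin.forall_fin_two]

/-- The axes are null, so sets of types need only be compared on the open quadrant. -/
lemma preimage_pair_ae_eq {A : Set (Fin 2 → ℝ)} {S : Set (ℝ × ℝ)} (hA : A ⊆ typeSpace 2)
    (hS : S ⊆ quadrant 0 0) (h : ∀ z ∈ quadrant 0 0, ![z.1, z.2] ∈ A ↔ z ∈ S) :
    MeasurableEquiv.finTwoArrow.symm ⁻¹' A =ᵐ[volume] S := by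
  filter_upwards [ae_fst_ne_zero_and_snd_ne_zero] with z hz
  refine propext (Iff.trans (b := z ∈ quadrant 0 0 ∧ ![z.1, z.2] ∈ A) ⟨fun hzA => ?_, fun h' => h'.2⟩
    ⟨fun h' => (h z h'.1).1 h'.2, fun h' => ⟨hS h', (h z (hS h')).2 h'⟩⟩)
  obtain ⟨h1, h2⟩ := pair_mem_typeSpace_iff.1 (hA hzA)
  exact ⟨⟨lt_of_le_of_ne h1 hz.1.symm, lt_of_le_of_ne h2 hz.2.symm⟩, hzA⟩

lemma setIntegral_eq_setIntegral_pair {A : Set (Fin 2 → ℝ)} {S : Set (ℝ × ℝ)}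
    (hA : A ⊆ typeSpace 2) (hS : S ⊆ quadrant 0 0)
    (h : ∀ z ∈ quadrant 0 0, ![z.1, z.2] ∈ A ↔ z ∈ S) (g : (Fin 2 → ℝ) → ℝ) :
    ∫ z in A, g z = ∫ z in S, g ![z.1, z.2] := by
  rw [← setIntegral_congr_set (preimage_pair_ae_eq hA hS h)]
  exact (((volume_preserving_finTwoArrow ℝ).symm _).setIntegral_preimage_emb
    (MeasurableEquiv.measurableEmbedding _) g A).symm

lemma integrableOn_of_integrableOn_pair {A : Set (Fin 2 → ℝ)} {S : Set (ℝ × ℝ)}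
    (hA : A ⊆ typeSpace 2) (hS : S ⊆ quadrant 0 0)
    (h : ∀ z ∈ quadrant 0 0, ![z.1, z.2] ∈ A ↔ z ∈ S) {g : (Fin 2 → ℝ) → ℝ}
    (hg : IntegrableOn (fun z : ℝ × ℝ => g ![z.1, z.2]) S) : IntegrableOn g A := by
  refine (((volume_preserving_finTwoArrow ℝ).symm _).integrableOn_comp_preimage
    (MeasurableEquiv.measurableEmbedding _)).1 ?_
  exact hg.congr_set_ae (preimage_pair_ae_eq hA hS h)

lemma pair_mem_typeSpace_iff_mem_quadrant :
    ∀ z ∈ quadrant 0 0, ![z.1, z.2] ∈ typeSpace 2 ↔ z ∈ quadrant 0 0 :=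
  fun _ hz => ⟨fun _ => hz, fun _ => pair_mem_typeSpace_iff.2 ⟨hz.1.le, hz.2.le⟩⟩

lemma jointDensity_powerLawPair (z : Fin 2 → ℝ) :
    jointDensity powerLawPair z = 30 * weight 4 5 (z 0, z 1) := by
  simp only [jointDensity, powerLawPair, Fin.prod_univ_two, Matrix.cons_val_zero,
    Matrix.cons_val_one, weight]
  ring

/-- The density formula is differentiable at boundary points too, so the derivative within the type
space is the full one. Applied to `z`, it is the derivative of `t ↦ f (t • z)` at 1. -/
lemma fderivWithin_jointDensity {z : Fin 2 → ℝ} (hz : z ∈ typeSpace 2) :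
    fderivWithin ℝ (jointDensity powerLawPair) (typeSpace 2) z z =
      -(30 * weight 4 5 (z 0, z 1) * (6 * (z 0 / (1 + z 0)) + 7 * (z 1 / (1 + z 1)))) := by
  have h0 : 0 < 1 + z 0 := by have : 0 ≤ z 0 := hz 0
                              linarith
  have h1 : 0 < 1 + z 1 := by have : 0 ≤ z 1 := hz 1
                              linarith
  have hu : UniqueDiffWithinAt ℝ (typeSpace 2) z := by
    have : UniqueDiffOn ℝ (typeSpace 2) := by
      rw [typeSpace, ← pi_univ_Ici]
      exact UniqueDiffOn.univ_pi fun i => uniqueDiffOn_Ici _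
    exact this z hz
  have e : jointDensity powerLawPair =
      fun z => 30 * (1 / (1 + z 0) ^ (4 + 2) * (1 / (1 + z 1) ^ (5 + 2))) :=
    funext jointDensity_powerLawPair
  have hd : DifferentiableAt ℝ (jointDensity powerLawPair) z := by
    rw [e]
    have a0 : (1 + z 0) ^ (4 + 2) ≠ 0 := by positivity
    have a1 : (1 + z 1) ^ (5 + 2) ≠ 0 := by positivity
    fun_prop (disch := assumption)
  rw [hd.fderivWithin hu]
  have hl : HasDerivAt (fun t : ℝ => t • z) z 1 := by
    simpa using (hasDerivAt_id (1 : ℝ)).smul_const z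
  have hc := HasFDerivAt.comp_hasDerivAt_of_eq 1 hd.hasFDerivAt hl (one_smul ℝ z).symm
  have h2 := ((hasDerivAt_inv_one_add_mul_pow 4 (s := 1) (x := z 0) (by rwa [one_mul])).mul
    (hasDerivAt_inv_one_add_mul_pow 5 (s := 1) (x := z 1) (by rwa [one_mul]))).const_mul 30
  rw [hc.unique (f := jointDensity powerLawPair ∘ fun t : ℝ => t • z) (by rw [e]; exact h2)]
  simp only [weight, one_mul]
  push_cast
  ring

/-- Writing `t / (1 + t) = 1 - 1 / (1 + t)` in both coordinates produces the constant `10 = 6 + 7 -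
3`. -/
lemma nuDensity_powerLawPair {z : Fin 2 → ℝ} (hz : z ∈ typeSpace 2) :
    nuDensity powerLawPair z = -30 * (weight 4 5 (z 0, z 1) * slope 6 7 10 (z 0, z 1)) := by
  have h0 : 0 < 1 + z 0 := by have : 0 ≤ z 0 := hz 0
                              linarith
  have h1 : 0 < 1 + z 1 := by have : 0 ≤ z 1 := hz 1
                              linarith
  have e1 : z 0 / (1 + z 0) = 1 - 1 / (1 + z 0) := by field_simp; ring
  have e2 : z 1 / (1 + z 1) = 1 - 1 / (1 + z 1) := by field_simp; ring
  rw [nuDensity, fderivWithin_jointDensity hz, jointDensity_powerLawPair, e1, e2, slope]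
  push_cast
  ring

lemma muDensity_eq_neg_nuDensity {n : ℕ} (f : Fin n → ℝ → ℝ) (z : Fin n → ℝ) :
    muDensity f z = -nuDensity f z := by
  unfold muDensity nuDensity
  ring

lemma nuDensity_nonneg_iff {z : Fin 2 → ℝ} (hz : z ∈ typeSpace 2) :
    0 ≤ nuDensity powerLawPair z ↔ slope 6 7 10 (z 0, z 1) ≤ 0 := by
  have h0 : 0 ≤ z 0 := hz 0
  have h1 : 0 ≤ z 1 := hz 1
  have hw : 0 < weight 4 5 (z 0, z 1) := by unfold weight; positivity
  rw [nuDensity_powerLawPair hz]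
  constructor
  · intro h
    by_contra hcon
    nlinarith [mul_pos hw (not_le.1 hcon)]
  · intro h
    nlinarith [mul_nonpos_of_nonneg_of_nonpos hw.le h]

lemma mem_regionY_iff {z : Fin 2 → ℝ} :
    z ∈ regionY powerLawPair ↔ z ∈ typeSpace 2 ∧ z ≠ 0 ∧ slope 6 7 10 (z 0, z 1) ≤ 0 := by
  refine and_congr_right fun hz => and_congr_right fun _ => ?_
  rw [← nuDensity_nonneg_iff hz, nuDensity, neg_le_iff_add_nonneg]

lemma mem_regionX_iff {z : Fin 2 → ℝ} :
    z ∈ regionX powerLawPair ↔ z ∈ typeSpace 2 ∧ z ≠ 0 ∧ 0 < slope 6 7 10 (z 0, z 1) := by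
  refine and_congr_right fun hz => and_congr_right fun _ => ?_
  rw [← not_le, ← not_le, not_iff_not, ← nuDensity_nonneg_iff hz, nuDensity, neg_le_iff_add_nonneg]

lemma pair_ne_zero {z : ℝ × ℝ} (hz : z ∈ quadrant 0 0) : ![z.1, z.2] ≠ 0 := fun h =>
  (show (0 : ℝ) < z.1 from hz.1).ne' (congrFun h 0)

/-- The positive types with total value at most `p`. -/
def lowerRegion (p : ℝ) : Set (ℝ × ℝ) := {z | z ∈ quadrant 0 0 ∧ z.1 + z.2 ≤ p}

lemma measurableSet_lowerRegion (p : ℝ) : MeasurableSet (lowerRegion p) :=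
  (measurableSet_quadrant 0 0).inter
    (measurableSet_le (measurable_fst.add measurable_snd) measurable_const)

lemma lowerRegion_subset (p : ℝ) : lowerRegion p ⊆ quadrant 0 0 := fun _ hz => hz.1

lemma integral_lowerRegion_add_upperRegion (p : ℝ) {F : ℝ × ℝ → ℝ}
    (hF : IntegrableOn F (quadrant 0 0)) :
    (∫ z in lowerRegion p, F z) + ∫ z in upperRegion p, F z = ∫ z in quadrant 0 0, F z := by
  rw [← setIntegral_union (disjoint_left.2 fun z h1 h2 => absurd h1.2 (not_le.2 h2.2.2))
    (measurableSet_upperRegion p) (hF.mono_set (lowerRegion_subset p))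
    (hF.mono_set (upperRegion_subset p))]
  congr 2
  ext z
  refine ⟨fun h => h.elim (fun h => h.1) fun h => upperRegion_subset p h, fun h => ?_⟩
  rcases le_or_gt (z.1 + z.2) p with h' | h'
  · exact Or.inl ⟨h, h'⟩
  · exact Or.inr ⟨h.1, h.2, h'⟩

lemma integrableOn_weight_mul_slope :
    IntegrableOn (fun z => weight 4 5 z * slope 6 7 10 z) (quadrant 0 0) :=
  integrableOn_mul_slope 6 7 10 (measurableSet_quadrant 0 0) subset_rfl
    (integrableOn_weight 4 5 le_rfl le_rfl)

lemma integral_quadrant_weight_mul_slope :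
    ∫ z in quadrant 0 0, weight 4 5 z * slope 6 7 10 z = -(1 / 30) := by
  rw [integral_weight_mul_slope_quadrant le_rfl]
  norm_num

lemma setIntegral_nuDensity {A : Set (Fin 2 → ℝ)} {S : Set (ℝ × ℝ)}
    (hA : A ⊆ typeSpace 2) (hS : S ⊆ quadrant 0 0) (hSm : MeasurableSet S)
    (h : ∀ z ∈ quadrant 0 0, ![z.1, z.2] ∈ A ↔ z ∈ S) :
    ∫ z in A, nuDensity powerLawPair z = -30 * ∫ z in S, weight 4 5 z * slope 6 7 10 z := by
  rw [setIntegral_eq_setIntegral_pair hA hS h, ← integral_const_mul]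
  refine setIntegral_congr_fun hSm fun z hz => ?_
  exact nuDensity_powerLawPair
    ((pair_mem_typeSpace_iff_mem_quadrant z (hS hz)).2 (hS hz))

/-- The density has total mass `-1/30` on the quadrant, so its mass below the line is that minus
`upperMass p`. Criticality thus amounts to `upperMass p = 0` together with the inclusion in
`regionY`. -/
lemma setIntegral_zeroRegion {p : ℝ} (hp : 0 ≤ p) :
    ∫ z in zeroRegion 2 p, nuDensity powerLawPair z = 1 + 30 * upperMass p := by
  rw [setIntegral_nuDensity (fun _ hz => hz.1) (lowerRegion_subset p) (measurableSet_lowerRegion p)]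
  · have h := integral_lowerRegion_add_upperRegion p integrableOn_weight_mul_slope
    rw [integral_quadrant_weight_mul_slope, integral_upperRegion_eq hp] at h
    linarith
  · intro z hz
    simp only [zeroRegion, lowerRegion, mem_ofPred_eq, Fin.sum_univ_two, Matrix.cons_val_zero,
      Matrix.cons_val_one, hz, pair_mem_typeSpace_iff_mem_quadrant z hz, true_and, ne_eq,
      pair_ne_zero hz, not_false_eq_true]

lemma setIntegral_regionY_sub_regionX :
    (∫ z in regionY powerLawPair, nuDensity powerLawPair z) -
      ∫ z in regionX powerLawPair, muDensity powerLawPair z = 1 := by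
  simp only [muDensity_eq_neg_nuDensity]
  have hY : MeasurableSet {z | z ∈ quadrant 0 0 ∧ slope 6 7 10 z ≤ 0} :=
    (measurableSet_quadrant 0 0).inter (measurableSet_le (measurable_slope 6 7 10) measurable_const)
  have hX : MeasurableSet {z | z ∈ quadrant 0 0 ∧ 0 < slope 6 7 10 z} :=
    (measurableSet_quadrant 0 0).inter (measurableSet_lt measurable_const (measurable_slope 6 7 10))
  rw [integral_neg, sub_neg_eq_add,
    setIntegral_nuDensity (fun _ hz => hz.1) (fun _ hz => hz.1) hY,
    setIntegral_nuDensity (fun _ hz => hz.1) (fun _ hz => hz.1) hX, ← mul_add,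
    ← setIntegral_union (disjoint_left.2 fun z h1 h2 => absurd h1.2 (not_le.2 h2.2)) hX
      (integrableOn_weight_mul_slope.mono_set fun _ hz => hz.1)
      (integrableOn_weight_mul_slope.mono_set fun _ hz => hz.1)]
  · have : {z | z ∈ quadrant 0 0 ∧ slope 6 7 10 z ≤ 0} ∪ {z | z ∈ quadrant 0 0 ∧ 0 < slope 6 7 10 z}
        = quadrant 0 0 := by
      ext z
      refine ⟨fun h => h.elim (fun h => h.1) fun h => h.1, fun h => ?_⟩
      rcases le_or_gt (slope 6 7 10 z) 0 with h' | h'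
      · exact Or.inl ⟨h, h'⟩
      · exact Or.inr ⟨h, h'⟩
    rw [this, integral_quadrant_weight_mul_slope]
    norm_num
  · intro z hz
    simp only [mem_regionX_iff, mem_ofPred_eq, Matrix.cons_val_zero,
      Matrix.cons_val_one, hz, pair_mem_typeSpace_iff_mem_quadrant z hz, true_and, ne_eq,
      pair_ne_zero hz, not_false_eq_true]
  · intro z hz
    simp only [mem_regionY_iff, mem_ofPred_eq, Matrix.cons_val_zero,
      Matrix.cons_val_one, hz, pair_mem_typeSpace_iff_mem_quadrant z hz, true_and, ne_eq,
      pair_ne_zero hz, not_false_eq_true]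

lemma slope_neg {z : ℝ × ℝ} (h1 : 0 ≤ z.1) (h2 : 0 ≤ z.2) (h : z.1 + z.2 ≤ 0.36) :
    slope 6 7 10 z < 0 := by
  rw [slope, sub_sub, sub_neg, div_add_div _ _ (by positivity) (by positivity),
    lt_div_iff₀ (by positivity)]
  nlinarith [sq_nonneg (z.1 - z.2)]

lemma isCriticalBundlePrice_of_upperMass_eq_zero {p : ℝ} (hp : 0 < p) (hp' : p ≤ 0.36)
    (h : upperMass p = 0) : IsCriticalBundlePrice powerLawPair p := by
  have h1 : ∫ z in zeroRegion 2 p, nuDensity powerLawPair z = 1 := by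
    rw [setIntegral_zeroRegion hp.le, h]
    norm_num
  refine ⟨hp, fun z hz => mem_regionY_iff.2 ⟨hz.1, hz.2.1, (slope_neg (hz.1 0) (hz.1 1) ?_).le⟩,
    h1.trans setIntegral_regionY_sub_regionX.symm, h1⟩
  have := hz.2.2
  rw [Fin.sum_univ_two] at this
  exact this.trans hp'

/-- Equal masses would give the band between the two lines mass zero. The density is nonpositive
there, by the inclusion in `regionY`, so it would vanish almost everywhere, yet just above `a` it is
strictly negative. -/
lemma upperMass_ne_of_lt {a b : ℝ} (ha : 0 < a) (ha' : a < 0.36) (hab : a < b)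
    (hb : zeroRegion 2 b ⊆ regionY powerLawPair) : upperMass a ≠ upperMass b := by
  intro h
  have hi := integrableOn_weight_mul_slope
  have h1 := integral_lowerRegion_add_upperRegion a hi
  have h2 := integral_lowerRegion_add_upperRegion b hi
  rw [integral_upperRegion_eq ha.le] at h1
  rw [integral_upperRegion_eq (ha.trans hab).le, ← h1, h, add_left_inj] at h2
  have hsub : lowerRegion a ⊆ lowerRegion b := fun z hz => ⟨hz.1, hz.2.trans hab.le⟩
  have hDm := (measurableSet_lowerRegion b).diff (measurableSet_lowerRegion a)
  have h3 : ∫ z in lowerRegion b \ lowerRegion a, -(weight 4 5 z * slope 6 7 10 z) = 0 := by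
    rw [integral_neg, setIntegral_sdiff (measurableSet_lowerRegion a)
      (hi.mono_set (lowerRegion_subset b)) hsub, h2, sub_self, neg_zero]
  have hnn : ∀ z ∈ lowerRegion b, 0 ≤ -(weight 4 5 z * slope 6 7 10 z) := by
    intro z hz
    have hm : ![z.1, z.2] ∈ zeroRegion 2 b :=
      ⟨(pair_mem_typeSpace_iff_mem_quadrant z hz.1).2 hz.1, pair_ne_zero hz.1, by
        rw [Fin.sum_univ_two]; exact hz.2⟩
    exact neg_nonneg.2 (mul_nonpos_of_nonneg_of_nonpos (weight_pos hz.1).le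
      (mem_regionY_iff.1 (hb hm)).2.2)
  rw [setIntegral_eq_zero_iff_of_nonneg_ae ((ae_restrict_iff' hDm).2
    (Filter.Eventually.of_forall fun z hz => hnn z hz.1))
    (hi.mono_set (sdiff_subset.trans (lowerRegion_subset b))).neg,
    Filter.EventuallyEq, ae_restrict_iff' hDm] at h3
  -- The minimum keeps the open set `O` inside the band and inside the range where `slope_neg`
  -- applies.
  set c := min b 0.36 with hc
  have hac : a < c := lt_min hab ha'
  set O : Set (ℝ × ℝ) := {z | 0 < z.1 ∧ 0 < z.2 ∧ a < z.1 + z.2 ∧ z.1 + z.2 < c} with hO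
  have hOo : IsOpen O := (isOpen_lt continuous_const continuous_fst).inter
    ((isOpen_lt continuous_const continuous_snd).inter
      ((isOpen_lt continuous_const (continuous_fst.add continuous_snd)).inter
        (isOpen_lt (continuous_fst.add continuous_snd) continuous_const)))
  have hOne : O.Nonempty := by
    refine ⟨((a + c) / 4, (a + c) / 4), ?_, ?_, ?_, ?_⟩ <;> simp only <;> linarith
  have hpos := hOo.measure_pos volume hOne
  refine hpos.ne' (measure_mono_null (fun z hz => ?_) h3)
  intro hzero
  have hq : z ∈ quadrant 0 0 := ⟨hz.1, hz.2.1⟩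
  have h4 := hzero ⟨⟨hq, hz.2.2.2.le.trans (min_le_left _ _)⟩, fun h' => absurd h'.2 (not_le.2 hz.2.2.1)⟩
  have h5 := slope_neg (z := z) hz.1.le hz.2.1.le (hz.2.2.2.le.trans (min_le_right _ _))
  have h6 := mul_neg_of_pos_of_neg (weight_pos (m := 4) (n := 5) hq) h5
  simp only [Pi.zero_apply] at h4
  linarith

lemma eq_of_isCriticalBundlePrice {p q : ℝ} (hp' : p < 0.36)
    (hp : IsCriticalBundlePrice powerLawPair p) (hq : IsCriticalBundlePrice powerLawPair q) :
    q = p := by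
  have h : ∀ {r}, IsCriticalBundlePrice powerLawPair r → upperMass r = 0 := by
    intro r hr
    have := hr.2.2.2
    rw [setIntegral_zeroRegion hr.1.le] at this
    linarith
  rcases lt_trichotomy q p with hlt | heq | hlt
  · exact absurd ((h hq).trans (h hp).symm) (upperMass_ne_of_lt hq.1 (hlt.trans hp') hlt hp.2.1)
  · exact heq
  · exact absurd ((h hp).trans (h hq).symm) (upperMass_ne_of_lt hp.1 hp' hlt hq.2.1)

/-! ### Incentive compatible mechanisms through their utility -/

namespace Mechanism

/-- The utility of a truthful bidder. -/
def truthfulUtility {n : ℕ} (M : Mechanism n) (z : Fin n → ℝ) : ℝ := utility z (M.alloc z) (M.price z)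

lemma IsIC.subgradient {n : ℕ} {M : Mechanism n} (hM : M.IsIC) {z z' : Fin n → ℝ}
    (hz : z ∈ typeSpace n) (hz' : z' ∈ typeSpace n) :
    M.truthfulUtility z + ∑ i, (z' i - z i) * M.alloc z i ≤ M.truthfulUtility z' := by
  have h := hM z' hz' z hz
  simp only [truthfulUtility, utility, sub_mul, Finset.sum_sub_distrib] at h ⊢
  linarith

/-- The truthful utility as a function on the plane, extended by projection to the quadrant. -/
def planeUtility (M : Mechanism 2) (z : ℝ × ℝ) : ℝ := M.truthfulUtility ![max z.1 0, max z.2 0]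

/-- The expected value of the truthful allocation, as a function on the plane. -/
def planeValue (M : Mechanism 2) (z : ℝ × ℝ) : ℝ :=
  z.1 * M.alloc ![z.1, z.2] 0 + z.2 * M.alloc ![z.1, z.2] 1

variable {M : Mechanism 2}

lemma posPart_mem_typeSpace (z : ℝ × ℝ) : ![max z.1 0, max z.2 0] ∈ typeSpace 2 :=
  pair_mem_typeSpace_iff (z := (max z.1 0, max z.2 0)).2 ⟨le_max_right _ _, le_max_right _ _⟩

lemma planeUtility_eq {z : ℝ × ℝ} (hz : z ∈ quadrant 0 0) :
    M.planeUtility z = M.truthfulUtility ![z.1, z.2] := by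
  have h1 : 0 < z.1 := hz.1
  have h2 : 0 < z.2 := hz.2
  rw [planeUtility, max_eq_left h1.le, max_eq_left h2.le]

lemma price_eq {z : ℝ × ℝ} (hz : z ∈ quadrant 0 0) :
    M.price ![z.1, z.2] = M.planeValue z - M.planeUtility z := by
  rw [planeUtility_eq hz]
  simp [truthfulUtility, utility, planeValue, Fin.sum_univ_two]

lemma IsIC.planeUtility_sub_le (hM : M.IsIC) (z z' : ℝ × ℝ) :
    ∃ a ∈ Icc (0 : ℝ) 1, ∃ b ∈ Icc (0 : ℝ) 1, M.planeUtility z +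
      (max z'.1 0 - max z.1 0) * a + (max z'.2 0 - max z.2 0) * b ≤ M.planeUtility z' := by
  have h := hM.subgradient (posPart_mem_typeSpace z) (posPart_mem_typeSpace z')
  refine ⟨_, M.alloc_mem _ (posPart_mem_typeSpace z) 0, _,
    M.alloc_mem _ (posPart_mem_typeSpace z) 1, ?_⟩
  simpa only [planeUtility, Fin.sum_univ_two, Matrix.cons_val_zero, Matrix.cons_val_one,
    ← add_assoc] using h

lemma IsIC.lipschitzWith_planeUtility (hM : M.IsIC) : LipschitzWith 2 M.planeUtility := by
  refine LipschitzWith.of_le_add_mul 2 fun z z' => ?_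
  obtain ⟨a, ha, b, hb, h⟩ := hM.planeUtility_sub_le z z'
  have h1 : |max z'.1 0 - max z.1 0| ≤ dist z z' := by
    rw [dist_comm]
    exact (abs_max_sub_max_le_abs _ _ _).trans (le_max_left _ _)
  have h2 : |max z'.2 0 - max z.2 0| ≤ dist z z' := by
    rw [dist_comm]
    exact (abs_max_sub_max_le_abs _ _ _).trans (le_max_right _ _)
  have aux : ∀ t a : ℝ, a ∈ Icc (0 : ℝ) 1 → -|t| ≤ t * a := by
    intro t a ha
    have h3 : |t * a| ≤ |t| := by
      rw [abs_mul, abs_of_nonneg ha.1]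
      exact mul_le_of_le_one_right (abs_nonneg _) ha.2
    linarith [neg_abs_le (t * a)]
  have h3 := aux _ a ha |>.trans' (neg_le_neg h1)
  have h4 := aux _ b hb |>.trans' (neg_le_neg h2)
  push_cast
  linarith

lemma IsIR.planeUtility_nonneg (hM : M.IsIR) (z : ℝ × ℝ) : 0 ≤ M.planeUtility z :=
  hM _ (posPart_mem_typeSpace z)

lemma IsIC.planeUtility_le (hM : M.IsIC) {z : ℝ × ℝ} (hz : z ∈ quadrant 0 0) :
    M.planeUtility z ≤ M.planeUtility 0 + z.1 + z.2 := by
  obtain ⟨a, ha, b, hb, h⟩ := hM.planeUtility_sub_le z 0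
  have h1 : 0 < z.1 := hz.1
  have h2 : 0 < z.2 := hz.2
  simp only [Prod.fst_zero, Prod.snd_zero, max_self, max_eq_left h1.le, max_eq_left h2.le] at h
  nlinarith [mul_le_of_le_one_right h1.le ha.2, mul_le_of_le_one_right h2.le hb.2]

lemma planeValue_mem {z : ℝ × ℝ} (hz : z ∈ quadrant 0 0) :
    0 ≤ M.planeValue z ∧ M.planeValue z ≤ z.1 + z.2 := by
  have h1 : 0 < z.1 := hz.1
  have h2 : 0 < z.2 := hz.2
  have hm := (pair_mem_typeSpace_iff_mem_quadrant z hz).2 hz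
  have ha := M.alloc_mem _ hm 0
  have hb := M.alloc_mem _ hm 1
  unfold planeValue
  exact ⟨add_nonneg (mul_nonneg h1.le ha.1) (mul_nonneg h2.le hb.1),
    add_le_add (mul_le_of_le_one_right h1.le ha.2) (mul_le_of_le_one_right h2.le hb.2)⟩

lemma IsIC.radial_subgradient (hM : M.IsIC) {z : ℝ × ℝ} (hz : z ∈ quadrant 0 0) {t : ℝ}
    (ht : 0 < t) : M.planeUtility z + (t - 1) * M.planeValue z ≤ M.planeUtility (t • z) := by
  have hz' := smul_mem_quadrant hz ht
  have h := hM.subgradient ((pair_mem_typeSpace_iff_mem_quadrant z hz).2 hz)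
    ((pair_mem_typeSpace_iff_mem_quadrant _ hz').2 hz')
  rw [planeUtility_eq hz, planeUtility_eq hz']
  refine le_trans (le_of_eq ?_) h
  simp only [planeValue, Fin.sum_univ_two, Matrix.cons_val_zero, Matrix.cons_val_one,
    Prod.smul_fst, Prod.smul_snd, smul_eq_mul]
  ring

/-- Along the ray through `z`, the utility minus its supporting line has a minimum at `t = 1`. -/
lemma IsIC.fderiv_planeUtility (hM : M.IsIC) {z : ℝ × ℝ} (hz : z ∈ quadrant 0 0)
    (hd : DifferentiableAt ℝ M.planeUtility z) :
    fderiv ℝ M.planeUtility z z = M.planeValue z := by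
  have hl : HasDerivAt (fun t : ℝ => t • z) z 1 := by
    simpa using (hasDerivAt_id (1 : ℝ)).smul_const z
  have hc := HasFDerivAt.comp_hasDerivAt_of_eq 1 hd.hasFDerivAt hl (one_smul ℝ z).symm
  have hs := hc.sub (((hasDerivAt_id (1 : ℝ)).sub_const 1).mul_const (M.planeValue z))
  have hmin : IsLocalMin ((M.planeUtility ∘ fun t : ℝ => t • z) -
      fun t : ℝ => (id t - 1) * M.planeValue z) 1 := by
    filter_upwards [lt_mem_nhds (zero_lt_one' ℝ)] with t ht
    have := hM.radial_subgradient hz ht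
    simp only [Pi.sub_apply, Function.comp_apply, one_smul, id, sub_self, zero_mul, sub_zero]
    linarith
  have := hmin.hasDerivAt_eq_zero hs
  linarith

/-- Allocations are not assumed measurable. By Rademacher's theorem the Lipschitz utility is
differentiable almost everywhere, and there the value is its radial derivative, a measurable
function. -/
lemma IsIC.aestronglyMeasurable_planeValue (hM : M.IsIC) :
    AEStronglyMeasurable M.planeValue (volume.restrict (quadrant 0 0)) := by
  have hm : Measurable fun z : ℝ × ℝ => z.1 * fderiv ℝ M.planeUtility z (1, 0) +
      z.2 * fderiv ℝ M.planeUtility z (0, 1) :=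
    (measurable_fst.mul (measurable_fderiv_apply_const ℝ _ _)).add
      (measurable_snd.mul (measurable_fderiv_apply_const ℝ _ _))
  refine hm.aestronglyMeasurable.congr ?_
  rw [Filter.EventuallyEq, ae_restrict_iff' (measurableSet_quadrant 0 0)]
  filter_upwards [hM.lipschitzWith_planeUtility.ae_differentiableAt] with z hd hz
  rw [← hM.fderiv_planeUtility hz hd, ← smul_eq_mul, ← smul_eq_mul, ← map_smul, ← map_smul,
    ← map_add]
  simp

lemma IsIC.growth (hM : M.IsIC) (hM' : M.IsIR) {z : ℝ × ℝ} (hz : z ∈ quadrant 0 0) :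
    |M.planeUtility z| ≤ (M.planeUtility 0 + 1) * ((1 + z.1) * (1 + z.2)) ∧
    |M.planeValue z| ≤ (M.planeUtility 0 + 1) * ((1 + z.1) * (1 + z.2)) := by
  have h1 : 0 < z.1 := hz.1
  have h2 : 0 < z.2 := hz.2
  have h0 := hM'.planeUtility_nonneg 0
  obtain ⟨h3, h4⟩ := M.planeValue_mem hz
  rw [abs_of_nonneg (hM'.planeUtility_nonneg z), abs_of_nonneg h3]
  have h5 := mul_pos h1 h2
  have h6 : 0 ≤ M.planeUtility 0 * (z.1 + z.2 + z.1 * z.2) := by positivity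
  constructor
  · nlinarith [hM.planeUtility_le hz]
  · nlinarith

lemma IsIC.hasRevenue (hM : M.IsIC) (hM' : M.IsIR) : M.HasRevenue powerLawPair := by
  refine integrableOn_of_integrableOn_pair subset_rfl subset_rfl
    pair_mem_typeSpace_iff_mem_quadrant ?_
  have h1 := integrableOn_mul_weight_of_bound (m := 4) (n := 5) (by norm_num) (by norm_num)
    hM.lipschitzWith_planeUtility.continuous.measurable.aestronglyMeasurable
    fun z hz => (hM.growth hM' hz).1
  have h2 := integrableOn_mul_weight_of_bound (m := 4) (n := 5) (by norm_num) (by norm_num)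
    hM.aestronglyMeasurable_planeValue fun z hz => (hM.growth hM' hz).2
  refine IntegrableOn.congr_fun ((h2.sub h1).const_mul 30) (fun z hz => ?_)
    (measurableSet_quadrant 0 0)
  simp only [price_eq hz, jointDensity_powerLawPair, Matrix.cons_val_zero, Matrix.cons_val_one,
    Pi.sub_apply]
  ring

lemma IsIC.revenue_eq (hM : M.IsIC) (hM' : M.IsIR) : M.revenue powerLawPair =
    30 * ∫ z in quadrant 0 0, M.planeUtility z * weight 4 5 z * slope 6 7 10 z := by
  have h := integral_payment (m := 4) (n := 5) (by norm_num) (by norm_num)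
    (add_nonneg (hM'.planeUtility_nonneg 0) zero_le_one)
    hM.lipschitzWith_planeUtility.continuous.measurable (fun z hz => (hM.growth hM' hz).1)
    hM.aestronglyMeasurable_planeValue (fun z hz => (hM.growth hM' hz).2)
    fun z hz t ht => hM.radial_subgradient hz ht
  rw [show ((4 : ℕ) : ℝ) + 2 = 6 by norm_num, show ((5 : ℕ) : ℝ) + 2 = 7 by norm_num,
    show ((4 : ℕ) : ℝ) + (5 : ℕ) + 1 = 10 by norm_num] at h
  rw [← h, revenue, setIntegral_eq_setIntegral_pair subset_rfl subset_rfl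
    pair_mem_typeSpace_iff_mem_quadrant, ← integral_const_mul]
  refine setIntegral_congr_fun (measurableSet_quadrant 0 0) fun z hz => ?_
  simp only [price_eq hz, jointDensity_powerLawPair, Matrix.cons_val_zero, Matrix.cons_val_one]
  ring

/-- Allocation probabilities are at most 1, so the utility never rises faster than the total value.
Above the line this function is the bundle's utility minus that of `M`. -/
lemma IsIC.tameMonotone (hM : M.IsIC) (hM' : M.IsIR) {p : ℝ} (hp : 0 ≤ p) :
    TameMonotone fun z => max z.1 0 + max z.2 0 - p - M.planeUtility z where
  mono := by
    intro z z' hzz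
    obtain ⟨a, ha, b, hb, h⟩ := hM.planeUtility_sub_le z' z
    have h1 : max z.1 0 ≤ max z'.1 0 := max_le_max_right 0 hzz.1
    have h2 : max z.2 0 ≤ max z'.2 0 := max_le_max_right 0 hzz.2
    simp only
    nlinarith [mul_le_of_le_one_right (sub_nonneg.2 h1) ha.2,
      mul_le_of_le_one_right (sub_nonneg.2 h2) hb.2]
  meas := by
    have := hM.lipschitzWith_planeUtility.continuous.measurable
    fun_prop
  bound := by
    have h0 := hM'.planeUtility_nonneg 0
    refine ⟨1 + p + (M.planeUtility 0 + 1), by positivity, fun z hz => ?_⟩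
    have h1 : 0 < z.1 := hz.1
    have h2 : 0 < z.2 := hz.2
    have h3 := (hM.growth hM' hz).1
    have h5 : |z.1 + z.2 - p| ≤ (1 + p) * ((1 + z.1) * (1 + z.2)) := by
      have h6 := mul_pos h1 h2
      have h7 : 0 ≤ p * (z.1 + z.2 + z.1 * z.2) := by positivity
      rw [abs_le]
      constructor <;> nlinarith
    simp only [max_eq_left h1.le, max_eq_left h2.le]
    refine (abs_sub _ _).trans ?_
    linarith

end Mechanism

/-! ### Optimality of the grand bundle -/

lemma utility_grandBundle (p : ℝ) (z z' : Fin 2 → ℝ) :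
    utility z ((grandBundle 2 p).alloc z') ((grandBundle 2 p).price z') =
      if p < ∑ i, z' i then (∑ i, z i) - p else 0 := by
  simp only [utility, grandBundle]
  split_ifs <;> simp

lemma isIC_grandBundle (p : ℝ) : (grandBundle 2 p).IsIC := by
  intro z _ z' _
  rw [utility_grandBundle, utility_grandBundle]
  split_ifs <;> linarith

lemma isIR_grandBundle (p : ℝ) : (grandBundle 2 p).IsIR := by
  intro z _
  rw [utility_grandBundle]
  split_ifs <;> linarith

lemma planeUtility_grandBundle {p : ℝ} {z : ℝ × ℝ} (hz : z ∈ quadrant 0 0) :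
    (grandBundle 2 p).planeUtility z = if p < z.1 + z.2 then z.1 + z.2 - p else 0 := by
  rw [Mechanism.planeUtility_eq hz, Mechanism.truthfulUtility, utility_grandBundle]
  simp only [Fin.sum_univ_two, Matrix.cons_val_zero, Matrix.cons_val_one]

theorem isOptimal_grandBundle {p : ℝ} (hp : 0.3 ≤ p) (hp' : p ≤ 0.36) (h0 : upperMass p = 0) :
    (grandBundle 2 p).IsOptimal powerLawPair := by
  have hp0 : 0 ≤ p := le_trans (by norm_num) hp
  have hG := isIC_grandBundle p
  have hG' := isIR_grandBundle p
  refine ⟨hG, hG', hG.hasRevenue hG', fun M hM hM' => ⟨hM.hasRevenue hM', ?_⟩⟩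
  rw [hM.revenue_eq hM', hG.revenue_eq hG']
  refine mul_le_mul_of_nonneg_left ?_ (by norm_num)
  have hint : ∀ {N : Mechanism 2}, N.IsIC → N.IsIR → IntegrableOn
      (fun z => N.planeUtility z * weight 4 5 z * slope 6 7 10 z) (quadrant 0 0) := fun hN hN' =>
    integrableOn_mul_slope 6 7 10 (measurableSet_quadrant 0 0) subset_rfl
      (integrableOn_mul_weight_of_bound (by norm_num) (by norm_num)
        hN.lipschitzWith_planeUtility.continuous.measurable.aestronglyMeasurable
        fun z hz => (hN.growth hN' hz).1)
  have hMi := hint hM hM'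
  have hGi := hint hG hG'
  rw [← integral_lowerRegion_add_upperRegion p hMi, ← integral_lowerRegion_add_upperRegion p hGi]
  -- Below the line a nonnegative utility meets a negative density and the bundle's utility is zero;
  -- above it, dominance is applied to the difference of utilities.
  refine add_le_add ?_ ?_
  · refine setIntegral_mono_on (hMi.mono_set (lowerRegion_subset p))
      (hGi.mono_set (lowerRegion_subset p)) (measurableSet_lowerRegion p) fun z hz => ?_
    have h1 : 0 < z.1 := hz.1.1
    have h2 : 0 < z.2 := hz.1.2
    rw [planeUtility_grandBundle hz.1, if_neg (not_lt.2 hz.2), zero_mul, zero_mul]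
    exact mul_nonpos_of_nonneg_of_nonpos
      (mul_nonneg (hM'.planeUtility_nonneg z) (weight_pos hz.1).le)
      (slope_neg h1.le h2.le (hz.2.trans hp')).le
  · have h1 := (hM.tameMonotone hM' hp0).integral_upperRegion_nonneg hp hp'
      ((integral_upperRegion_eq hp0).trans h0)
    rw [← sub_nonneg, ← integral_sub (hGi.mono_set (upperRegion_subset p))
      (hMi.mono_set (upperRegion_subset p))]
    refine h1.trans_eq (setIntegral_congr_fun (measurableSet_upperRegion p) fun z hz => ?_)
    have h2 : 0 < z.1 := hz.1
    have h3 : 0 < z.2 := hz.2.1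
    simp only [planeUtility_grandBundle (upperRegion_subset p hz), if_pos hz.2.2,
      max_eq_left h2.le, max_eq_left h3.le]
    ring

end BundlePricing

end

theorem mainTheorem7 :
    ∃ p : ℝ, |p - 0.35725| ≤ 0.000005 ∧
      BundlePricing.IsCriticalBundlePrice BundlePricing.powerLawPair p ∧
      (∀ q : ℝ, BundlePricing.IsCriticalBundlePrice BundlePricing.powerLawPair q → q = p) ∧
      (BundlePricing.grandBundle 2 p).IsOptimal BundlePricing.powerLawPair := by
  obtain ⟨p, ⟨h1, h2⟩, h0⟩ := BundlePricing.exists_upperMass_eq_zero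
  have hc := BundlePricing.isCriticalBundlePrice_of_upperMass_eq_zero
    (by norm_num at h1; linarith) (by norm_num at h2; linarith) h0
  refine ⟨p, ?_, hc, fun q hq =>
    BundlePricing.eq_of_isCriticalBundlePrice (by norm_num at h2; linarith) hc hq,
    BundlePricing.isOptimal_grandBundle (by norm_num at h1; linarith)
      (by norm_num at h2; linarith) h0⟩
  rw [abs_le]
  constructor <;> norm_num at h1 h2 ⊢ <;> linarith
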